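/- Let $H$ and $K$ be complex Hilbert spaces and let $\mathcal A\subset B(H,K)$ be a ternary ring of operators (TRO), that is, a norm-closed linear subspace with $xy^*z\in\mathcal A$ for all $x,y,z\in\mathcal A$. For a linear subspace $X\subset B(H,K)$ and $n\ge 1$, give $M_n(X)$ the norm inherited from $M_n(B(H,K))=B(H^n,K^n)$, where $H^n,K^n$ are Hilbert space direct sums. Let $P:\mathcal A\to\mathcal A$ be a linear map with $P^2=P$ that is completely contractive, i.e. $\|[P(a_{ij})]\|\le\|[a_{ij}]\|$ for all $n\ge1$ and all $[a_{ij}]\in M_n(\mathcal A)$. Then the range of $P$ is completely isometric to a TRO: there exist complex Hilbert spaces $H',K'$, a TRO $\mathcal B\subset B(H',K')$ and a linear bijection $\varphi:P(\mathcal A)\to\mathcal B$ such that $\|[\varphi(a_{ij})]\|=\|[a_{ij}]\|$ for all $n\ge1$ and all $[a_{ij}]\in M_n(P(\mathcal A))$. -/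

import Mathlib

universe u v w z

noncomputable section

namespace TernaryRing

/-- The operator from `Hⁿ` to `Kⁿ` (Hilbert space direct sums) whose matrix is `a`; its operator
norm is the norm of `a` as an element of `M_n(B(H, K))`. -/
def matrixOp {H : Type u} {K : Type v} [NormedAddCommGroup H] [InnerProductSpace ℂ H]
    [NormedAddCommGroup K] [InnerProductSpace ℂ K] {n : ℕ}
    (a : Matrix (Fin n) (Fin n) (H →L[ℂ] K)) :
    PiLp 2 (fun _ : Fin n => H) →L[ℂ] PiLp 2 (fun _ : Fin n => K) :=
  ((PiLp.continuousLinearEquiv 2 ℂ (fun _ : Fin n => K)).symm :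
      (Fin n → K) →L[ℂ] PiLp 2 (fun _ : Fin n => K)) ∘L
    ContinuousLinearMap.pi (fun i => ∑ j, a i j ∘L PiLp.proj 2 (fun _ : Fin n => H) j)

theorem matrixOp_apply {H : Type u} {K : Type v} [NormedAddCommGroup H] [InnerProductSpace ℂ H]
    [NormedAddCommGroup K] [InnerProductSpace ℂ K] {n : ℕ}
    (a : Matrix (Fin n) (Fin n) (H →L[ℂ] K)) (x : PiLp 2 (fun _ : Fin n => H)) (i : Fin n) :
    matrixOp a x i = ∑ j, a i j (x j) := by
  simp [matrixOp]

/-- The norm on `M_n(X)` of an operator space `X ⊆ B(H, K)`. -/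
def matrixNorm {H : Type u} {K : Type v} [NormedAddCommGroup H] [InnerProductSpace ℂ H]
    [NormedAddCommGroup K] [InnerProductSpace ℂ K] {X : Submodule ℂ (H →L[ℂ] K)} {n : ℕ}
    (a : Matrix (Fin n) (Fin n) X) : ℝ :=
  ‖matrixOp (a.map (fun x => (x : H →L[ℂ] K)))‖

/-- A ternary ring of operators: a norm closed linear subspace of `B(H, K)` that is closed under
the ternary product `x y* z`. -/
structure IsTRO {H : Type u} {K : Type v} [NormedAddCommGroup H] [InnerProductSpace ℂ H]
    [CompleteSpace H] [NormedAddCommGroup K] [InnerProductSpace ℂ K] [CompleteSpace K]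
    (A : Submodule ℂ (H →L[ℂ] K)) : Prop where
  isClosed : IsClosed (A : Set (H →L[ℂ] K))
  ternary_mem : ∀ x ∈ A, ∀ y ∈ A, ∀ z ∈ A, x ∘L (ContinuousLinearMap.adjoint y) ∘L z ∈ A

/-- All amplifications `φ_n : M_n(X) → M_n(Y)`, `[x_ij] ↦ [φ(x_ij)]`, are contractive. -/
def CompletelyContractive {H : Type u} {K : Type v} {H' : Type w} {K' : Type z}
    [NormedAddCommGroup H] [InnerProductSpace ℂ H] [NormedAddCommGroup K] [InnerProductSpace ℂ K]
    [NormedAddCommGroup H'] [InnerProductSpace ℂ H']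
    [NormedAddCommGroup K'] [InnerProductSpace ℂ K']
    {X : Submodule ℂ (H →L[ℂ] K)} {Y : Submodule ℂ (H' →L[ℂ] K')} (φ : X →ₗ[ℂ] Y) : Prop :=
  ∀ (n : ℕ) (a : Matrix (Fin n) (Fin n) X), matrixNorm (a.map φ) ≤ matrixNorm a

/-- There is a linear bijection from `X` onto `Y` all of whose amplifications are isometries. -/
def CompletelyIsometric {H : Type u} {K : Type v} {H' : Type w} {K' : Type z}
    [NormedAddCommGroup H] [InnerProductSpace ℂ H] [NormedAddCommGroup K] [InnerProductSpace ℂ K]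
    [NormedAddCommGroup H'] [InnerProductSpace ℂ H']
    [NormedAddCommGroup K'] [InnerProductSpace ℂ K']
    (X : Submodule ℂ (H →L[ℂ] K)) (Y : Submodule ℂ (H' →L[ℂ] K')) : Prop :=
  ∃ φ : X ≃ₗ[ℂ] Y, ∀ (n : ℕ) (a : Matrix (Fin n) (Fin n) X), matrixNorm (a.map φ) = matrixNorm a

end TernaryRing

end

noncomputable section

namespace TernaryRing

open scoped InnerProductSpace

/-! ### Unital completely positive maps and their sesquilinear forms. -/

section CompletelyPositive

variable {L : Type*} [NormedAddCommGroup L] [InnerProductSpace ℂ L]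

/-! Place `B(H, K)` in the upper right corner of `B(L)`, `L = K ⊕ H`. By Paulsen's off-diagonal
argument, complete contractivity of `P` makes `λ + a + b* ↦ λ + P a + (P b)*` completely positive
(`CompletelyContractive.re_nonneg`), and Arveson's theorem extends it to a unital completely
positive map on `B(L)` (`exists_isUCP_extension`). The maps that agree with `P` on the corner of `A`
form a compact semigroup under composition, so one of them, `Φ`, is idempotent
(`exists_idempotent_isUCP`).

An idempotent `Φ` satisfies the Choi–Effros identities (`IsUCP.map_mul_map`), so its range
multiplies associatively by `Φ (x y)`. This product is realised concretely: `Φ` gives `B(L) ⊗ L` a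
Stinespring semi-inner product, `Φ ⊗ id` is a self-adjoint projection there, and compressing left
multiplication to it gives a map `repLinear` that respects adjoints, is multiplicative on the range
of `Φ` (`repLinear_mul`) and preserves matrix norms there (`norm_matrixOp_repLinear`). Since `Φ`
agrees with `P` on the corner, the image of `P(A)` is closed under the ternary product, with `P (x
y* z)` as the ternary operation upstairs.

Positivity is expressed through real parts of quadratic forms, so matrices need not be self-adjoint
and adjoint-preservation is a consequence (`IsUCP.map_star`). -/

/-- A matrix of operators whose quadratic form has nonnegative real part. -/
def Accretive {ι : Type*} [Fintype ι] (c : ι → ι → L →L[ℂ] L) : Prop :=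
  ∀ ζ : ι → L, 0 ≤ (∑ i, ∑ j, ⟪ζ i, c i j (ζ j)⟫_ℂ).re

/-- A unital linear map on `B(L)` is completely positive when it preserves accretive matrices. -/
structure IsUCP (Φ : (L →L[ℂ] L) →ₗ[ℂ] (L →L[ℂ] L)) : Prop where
  map_one : Φ 1 = 1
  accretive : ∀ (n : ℕ) (c : Fin n → Fin n → L →L[ℂ] L), Accretive c →
    Accretive fun i j => Φ (c i j)

/-- The properties of `f a ξ η = ⟪ξ, Φ a η⟫` for a unital completely positive map `Φ`. -/
structure IsUCPForm (f : (L →L[ℂ] L) → L → L → ℂ) : Prop where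
  add_op : ∀ a b ξ η, f (a + b) ξ η = f a ξ η + f b ξ η
  smul_op : ∀ (t : ℂ) a ξ η, f (t • a) ξ η = t * f a ξ η
  add_left : ∀ a ξ ξ' η, f a (ξ + ξ') η = f a ξ η + f a ξ' η
  smul_left : ∀ (t : ℂ) a ξ η, f a (t • ξ) η = star t * f a ξ η
  add_right : ∀ a ξ η η', f a ξ (η + η') = f a ξ η + f a ξ η'
  smul_right : ∀ (t : ℂ) a ξ η, f a ξ (t • η) = t * f a ξ η
  one : ∀ ξ η, f 1 ξ η = ⟪ξ, η⟫_ℂ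
  pos : ∀ (n : ℕ) (c : Fin n → Fin n → L →L[ℂ] L), Accretive c →
    ∀ ζ : Fin n → L, 0 ≤ (∑ i, ∑ j, f (c i j) (ζ i) (ζ j)).re

theorem Accretive.reindex {ι κ : Type*} [Fintype ι] [Fintype κ] (e : κ ≃ ι)
    {c : ι → ι → L →L[ℂ] L} (hc : Accretive c) : Accretive fun i j => c (e i) (e j) := by
  intro ζ
  have := hc (ζ ∘ e.symm)
  rw [← e.sum_comp] at this
  simp_rw [← e.sum_comp (fun j => ⟪(ζ ∘ e.symm) (e _), c (e _) j ((ζ ∘ e.symm) j)⟫_ℂ)] at this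
  simpa using this

theorem IsUCP.map_accretive {Φ : (L →L[ℂ] L) →ₗ[ℂ] (L →L[ℂ] L)} (hΦ : IsUCP Φ)
    {ι : Type*} [Fintype ι] {c : ι → ι → L →L[ℂ] L} (hc : Accretive c) :
    Accretive fun i j => Φ (c i j) := by
  have h := (hΦ.accretive _ _ (hc.reindex (Fintype.equivFin ι).symm)).reindex (Fintype.equivFin ι)
  simpa using h

/-- Finite families indexed by a finset. -/
theorem IsUCP.sum_nonneg {Φ : (L →L[ℂ] L) →ₗ[ℂ] (L →L[ℂ] L)} (hΦ : IsUCP Φ)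
    {κ : Type*} (s : Finset κ) (c : κ → κ → L →L[ℂ] L)
    (hc : ∀ ζ : κ → L, 0 ≤ (∑ i ∈ s, ∑ j ∈ s, ⟪ζ i, c i j (ζ j)⟫_ℂ).re) (ζ : κ → L) :
    0 ≤ (∑ i ∈ s, ∑ j ∈ s, ⟪ζ i, Φ (c i j) (ζ j)⟫_ℂ).re := by
  classical
  have hacc : Accretive (fun i j : s => c i j) := by
    intro ω
    have := hc (fun k => if h : k ∈ s then ω ⟨k, h⟩ else 0)
    rw [← Finset.sum_coe_sort] at this
    simp_rw [← Finset.sum_coe_sort s] at this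
    simpa using this
  have := hΦ.map_accretive hacc (fun k => ζ k)
  rw [← Finset.sum_coe_sort]
  simp_rw [← Finset.sum_coe_sort s]
  exact this

theorem IsUCPForm.norm_le_half {f : (L →L[ℂ] L) → L → L → ℂ} (hf : IsUCPForm f)
    (a : L →L[ℂ] L) (ξ η : L) : ‖f a ξ η‖ ≤ ‖a‖ * (‖ξ‖ ^ 2 + ‖η‖ ^ 2) / 2 := by
  obtain ⟨z, hz, hzf⟩ : ∃ z : ℂ, ‖z‖ = 1 ∧ z * f a ξ η = -(‖f a ξ η‖ : ℂ) := by
    by_cases h : f a ξ η = 0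
    · exact ⟨1, by simp, by simp [h]⟩
    · have h' : (‖f a ξ η‖ : ℂ) ≠ 0 := by simpa using h
      refine ⟨-(‖f a ξ η‖ : ℂ) / f a ξ η, by simp [h], by field_simp⟩
  -- Only the real part of the form counts, so the off-diagonal pair `z a`, `(z a)*` may be merged
  -- into a single entry; this is the factor 2.
  let c : Fin 2 → Fin 2 → L →L[ℂ] L :=
    ![![(‖a‖ : ℂ) • 1, (2 * z) • a], ![(0 : ℂ) • 1, (‖a‖ : ℂ) • 1]]
  have hc : Accretive c := by
    intro ζ
    have h1 : ‖⟪ζ 0, (z • a) (ζ 1)⟫_ℂ‖ ≤ ‖ζ 0‖ * (‖a‖ * ‖ζ 1‖) := by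
      refine (norm_inner_le_norm _ _).trans ?_
      gcongr
      simpa [norm_smul, hz] using a.le_opNorm (ζ 1)
    have h2 := (abs_le.1 ((Complex.abs_re_le_norm _).trans h1)).1
    have h3 : (∑ i, ∑ j, ⟪ζ i, c i j (ζ j)⟫_ℂ).re
        = ‖a‖ * ‖ζ 0‖ ^ 2 + ‖a‖ * ‖ζ 1‖ ^ 2 + 2 * (⟪ζ 0, (z • a) (ζ 1)⟫_ℂ).re := by
      simp only [Fin.sum_univ_two, c]
      simp [inner_self_eq_norm_sq_to_K, ← Complex.ofReal_pow]
      ring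
    rw [h3]
    nlinarith [mul_nonneg (norm_nonneg a) (sq_nonneg (‖ζ 0‖ - ‖ζ 1‖))]
  have := hf.pos 2 c hc ![ξ, η]
  have h3 : (∑ i, ∑ j, f (c i j) (![ξ, η] i) (![ξ, η] j)).re
        = ‖a‖ * ‖ξ‖ ^ 2 + ‖a‖ * ‖η‖ ^ 2 + 2 * (z * f a ξ η).re := by
    simp only [Fin.sum_univ_two, c]
    simp only [Matrix.cons_val_zero, Matrix.cons_val_one, hf.smul_op, hf.one,
      inner_self_eq_norm_sq_to_K]
    simp [← Complex.ofReal_pow]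
    ring
  rw [h3, hzf] at this
  simp at this
  linarith

theorem IsUCPForm.norm_le {f : (L →L[ℂ] L) → L → L → ℂ} (hf : IsUCPForm f)
    (a : L →L[ℂ] L) (ξ η : L) : ‖f a ξ η‖ ≤ ‖a‖ * ‖ξ‖ * ‖η‖ := by
  by_cases hξ : ξ = 0
  · have := hf.smul_left 0 a 0 η
    simp only [smul_zero, star_zero, zero_mul] at this
    simp [hξ, this]
  by_cases hη : η = 0
  · have := hf.smul_right 0 a ξ 0
    simp only [smul_zero, zero_mul] at this
    simp [hη, this]
  have h1 : 0 < ‖ξ‖ := norm_pos_iff.2 hξ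
  have h2 : 0 < ‖η‖ := norm_pos_iff.2 hη
  have := hf.norm_le_half a ((‖ξ‖⁻¹ : ℂ) • ξ) ((‖η‖⁻¹ : ℂ) • η)
  rw [hf.smul_left, hf.smul_right] at this
  simp only [norm_mul, norm_star, norm_smul, norm_inv, Complex.norm_real, norm_norm,
    inv_mul_cancel₀ h1.ne', inv_mul_cancel₀ h2.ne'] at this
  have h3 : ‖ξ‖⁻¹ * (‖η‖⁻¹ * ‖f a ξ η‖) = ‖f a ξ η‖ / (‖ξ‖ * ‖η‖) := by
    field_simp
  rw [h3, div_le_iff₀ (by positivity)] at this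
  linarith

/-- Bounded sesquilinear forms on a Hilbert space come from operators. Extension and compactness
arguments can thus be run on scalar functions. -/
theorem IsUCPForm.exists_isUCP [CompleteSpace L] {f : (L →L[ℂ] L) → L → L → ℂ} (hf : IsUCPForm f) :
    ∃ Φ : (L →L[ℂ] L) →ₗ[ℂ] (L →L[ℂ] L), IsUCP Φ ∧ ∀ a ξ η, ⟪ξ, Φ a η⟫_ℂ = f a ξ η := by
  have key : ∀ a, ∃ T : L →L[ℂ] L, ∀ ξ η, ⟪ξ, T η⟫_ℂ = f a ξ η := by
    intro a
    let B : L →L⋆[ℂ] L →L[ℂ] ℂ := LinearMap.mkContinuous₂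
      (LinearMap.mk₂'ₛₗ (starRingEnd ℂ) (RingHom.id ℂ) (fun ξ η => f a ξ η)
        (fun x y w => hf.add_left a x y w) (fun t x w => hf.smul_left t a x w)
        (fun x y w => hf.add_right a x y w) (fun t x w => hf.smul_right t a x w)) ‖a‖
      (fun ξ η => hf.norm_le a ξ η)
    refine ⟨ContinuousLinearMap.adjoint (InnerProductSpace.continuousLinearMapOfBilin B), ?_⟩
    intro ξ η
    rw [ContinuousLinearMap.adjoint_inner_right,
      InnerProductSpace.continuousLinearMapOfBilin_apply]
    rfl
  choose T hT using key
  refine ⟨⟨⟨T, fun a b => ?_⟩, fun t a => ?_⟩, ⟨?_, ?_⟩, hT⟩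
  · ext η
    refine ext_inner_left ℂ fun ξ => ?_
    simp [inner_add_right, hT, hf.add_op]
  · ext η
    refine ext_inner_left ℂ fun ξ => ?_
    simp [inner_smul_right, hT, hf.smul_op]
  · ext η
    refine ext_inner_left ℂ fun ξ => ?_
    simp [hT, hf.one]
  · intro n c hc ζ
    simpa [hT] using hf.pos n c hc ζ

theorem IsUCP.isUCPForm {Φ : (L →L[ℂ] L) →ₗ[ℂ] (L →L[ℂ] L)} (hΦ : IsUCP Φ) :
    IsUCPForm fun a ξ η => ⟪ξ, Φ a η⟫_ℂ where
  add_op := by simp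
  smul_op := by simp
  add_left := by simp
  smul_left := by simp [mul_comm]
  add_right := by simp
  smul_right := by simp
  one := by simp [hΦ.map_one]
  pos := hΦ.accretive

end CompletelyPositive

/-! ### Arveson's extension theorem by way of positive functionals on formal sums. -/

section Extension

variable {L : Type*} [NormedAddCommGroup L] [InnerProductSpace ℂ L]

/-- The linear functional `∑ c(ξ, η) ↦ ∑ ⟪Z ξ, Φ (c(ξ, η)) (Z η)⟫` on formal sums. -/
def formalPairing (Φ : (L →L[ℂ] L) →ₗ[ℂ] (L →L[ℂ] L)) (Z : L →ₗ[ℂ] L) :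
    ((L × L) →₀ (L →L[ℂ] L)) →ₗ[ℂ] ℂ :=
  Finsupp.lsum ℂ fun p : L × L =>
    (innerₛₗ ℂ (Z p.1)) ∘ₗ (LinearMap.applyₗ (Z p.2)) ∘ₗ
      (ContinuousLinearMap.coeLM ℂ : (L →L[ℂ] L) →ₗ[ℂ] (L →ₗ[ℂ] L)) ∘ₗ Φ

theorem formalPairing_apply (Φ : (L →L[ℂ] L) →ₗ[ℂ] (L →L[ℂ] L)) (Z : L →ₗ[ℂ] L)
    (c : (L × L) →₀ (L →L[ℂ] L)) :
    formalPairing Φ Z c = ∑ p ∈ c.support, ⟪Z p.1, Φ (c p) (Z p.2)⟫_ℂ := by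
  simp [formalPairing, Finsupp.sum]

@[simp]
theorem formalPairing_single (Φ : (L →L[ℂ] L) →ₗ[ℂ] (L →L[ℂ] L)) (Z : L →ₗ[ℂ] L)
    (p : L × L) (a : L →L[ℂ] L) :
    formalPairing Φ Z (Finsupp.single p a) = ⟪Z p.1, Φ a (Z p.2)⟫_ℂ := by
  simp [formalPairing]

/-- The formal sums that define accretive operator matrices. -/
def accretiveCone (L : Type*) [NormedAddCommGroup L] [InnerProductSpace ℂ L] :
    PointedCone ℝ ((L × L) →₀ (L →L[ℂ] L)) where
  carrier := {c | ∀ Z : L →ₗ[ℂ] L, 0 ≤ (formalPairing LinearMap.id Z c).re}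
  add_mem' := fun {a b} ha hb Z => by
    simpa using add_nonneg (ha Z) (hb Z)
  zero_mem' := fun Z => by simp
  smul_mem' := fun t c hc Z => by
    have : t • c = ((t : ℝ) : ℂ) • c := by
      ext; rfl
    rw [this, map_smul]
    simpa using mul_nonneg t.2 (hc Z)

/-- Complete positivity on a subspace gives positivity of the associated functional. -/
theorem formalPairing_id_nonneg (S : Submodule ℂ (L →L[ℂ] L))
    (Φ : (L →L[ℂ] L) →ₗ[ℂ] (L →L[ℂ] L))
    (hΦ : ∀ (n : ℕ) (c : Fin n → Fin n → L →L[ℂ] L), (∀ i j, c i j ∈ S) → Accretive c →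
      Accretive fun i j => Φ (c i j))
    (c : (L × L) →₀ (L →L[ℂ] L)) (hcS : ∀ p, c p ∈ S) (hc : c ∈ accretiveCone L) :
    0 ≤ (formalPairing Φ LinearMap.id c).re := by
  classical
  -- The cone tests only linear `Z`, so linearly dependent vectors in `c` cannot be moved
  -- independently. Expanding them in an orthonormal basis of their span turns `c` into a matrix `C`
  -- over `S`, and every family `ζ` then comes from a linear `Z`.
  let F : Finset L := c.support.image Prod.fst ∪ c.support.image Prod.snd
  let W : Submodule ℂ L := Submodule.span ℂ (F : Set L)
  have : FiniteDimensional ℂ W := FiniteDimensional.span_finset ℂ F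
  let e := stdOrthonormalBasis ℂ W
  let n := Module.finrank ℂ W
  let r : Fin n → L → ℂ := fun i v => ⟪(e i : L), v⟫_ℂ
  have hr : ∀ v ∈ F, ∑ i, r i v • (e i : L) = v := by
    intro v hv
    have hvW : v ∈ W := Submodule.subset_span hv
    have := congrArg Subtype.val (e.sum_repr' ⟨v, hvW⟩)
    simpa [r] using this
  have h1 : ∀ p ∈ c.support, p.1 ∈ F := fun p hp =>
    Finset.mem_union_left _ (Finset.mem_image_of_mem _ hp)
  have h2 : ∀ p ∈ c.support, p.2 ∈ F := fun p hp =>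
    Finset.mem_union_right _ (Finset.mem_image_of_mem _ hp)
  let C : Fin n → Fin n → L →L[ℂ] L := fun i j =>
    ∑ p ∈ c.support, (star (r i p.1) * r j p.2) • c p
  have hC : ∀ (Ψ : (L →L[ℂ] L) →ₗ[ℂ] (L →L[ℂ] L)) (ζ : Fin n → L),
      ∑ i, ∑ j, ⟪ζ i, Ψ (C i j) (ζ j)⟫_ℂ =
        ∑ p ∈ c.support, ⟪∑ i, r i p.1 • ζ i, Ψ (c p) (∑ j, r j p.2 • ζ j)⟫_ℂ := by
    intro Ψ ζ
    simp only [C, map_sum, map_smul, sum_inner, inner_sum, inner_smul_left, inner_smul_right,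
      sum_apply, smul_apply, Finset.mul_sum]
    conv_rhs => rw [Finset.sum_comm]; enter [2, j]; rw [Finset.sum_comm]
    rw [Finset.sum_comm]
    refine Finset.sum_congr rfl fun j _ => Finset.sum_congr rfl fun i _ =>
      Finset.sum_congr rfl fun p _ => ?_
    rw [← starRingEnd_apply]
    ring
  have hacc : Accretive C := by
    intro ζ
    let Z : L →ₗ[ℂ] L := ∑ i, (innerₛₗ ℂ (e i : L)).smulRight (ζ i)
    have hZ : ∀ v, Z v = ∑ i, r i v • ζ i := fun v => by simp [Z, r]; rfl
    have := hc Z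
    rw [formalPairing_apply] at this
    have h := hC LinearMap.id ζ
    simp only [LinearMap.id_apply] at h this
    rw [h]
    simpa only [hZ] using this
  have := hΦ n C (fun i j => S.sum_mem fun p _ => S.smul_mem _ (hcS p)) hacc (fun i => e i)
  rw [hC, Finset.sum_congr rfl fun p hp => by rw [hr _ (h1 p hp), hr _ (h2 p hp)]] at this
  rw [formalPairing_apply]
  exact this

/-- The domination hypothesis of the Riesz extension theorem: an entry `a` at `(ξ, η)` is absorbed
by `‖a‖ • 1` at `(ξ, ξ)` and at `(η, η)`. -/
theorem exists_add_mem_accretiveCone (S : Submodule ℂ (L →L[ℂ] L)) (hS : 1 ∈ S)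
    (y : (L × L) →₀ (L →L[ℂ] L)) :
    ∃ x : (L × L) →₀ (L →L[ℂ] L), (∀ p, x p ∈ S) ∧ x + y ∈ accretiveCone L := by
  classical
  induction y using Finsupp.induction_linear with
  | zero => exact ⟨0, fun _ => S.zero_mem, by simp⟩
  | add f g hf hg =>
    obtain ⟨x, hx, hxf⟩ := hf
    obtain ⟨x', hx', hxg⟩ := hg
    refine ⟨x + x', fun p => S.add_mem (hx p) (hx' p), ?_⟩
    rw [add_add_add_comm]
    exact add_mem hxf hxg
  | single p a =>
    have hsingle : ∀ (p q : L × L), (Finsupp.single p ((‖a‖ : ℂ) • (1 : L →L[ℂ] L))) q ∈ S := by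
      intro p q
      rw [Finsupp.single_apply]
      split_ifs
      · exact S.smul_mem _ hS
      · exact S.zero_mem
    refine ⟨Finsupp.single (p.1, p.1) ((‖a‖ : ℂ) • 1) + Finsupp.single (p.2, p.2) ((‖a‖ : ℂ) • 1),
      fun q => S.add_mem (hsingle _ q) (hsingle _ q), fun Z => ?_⟩
    have h1 : ‖⟪Z p.1, a (Z p.2)⟫_ℂ‖ ≤ ‖Z p.1‖ * (‖a‖ * ‖Z p.2‖) := by
      refine (norm_inner_le_norm _ _).trans ?_
      gcongr
      exact a.le_opNorm _
    have h2 := (abs_le.1 ((Complex.abs_re_le_norm _).trans h1)).1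
    have h3 : (formalPairing LinearMap.id Z (Finsupp.single (p.1, p.1) ((‖a‖ : ℂ) • 1) +
        Finsupp.single (p.2, p.2) ((‖a‖ : ℂ) • 1) + Finsupp.single p a)).re
        = ‖a‖ * ‖Z p.1‖ ^ 2 + ‖a‖ * ‖Z p.2‖ ^ 2 + (⟪Z p.1, a (Z p.2)⟫_ℂ).re := by
      simp [inner_self_eq_norm_sq_to_K, ← Complex.ofReal_pow]
    rw [h3]
    nlinarith [mul_nonneg (norm_nonneg a) (sq_nonneg (‖Z p.1‖ - ‖Z p.2‖)),
      mul_nonneg (norm_nonneg a) (sq_nonneg (‖Z p.1‖)),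
      mul_nonneg (norm_nonneg a) (sq_nonneg (‖Z p.2‖))]

/-- A positive functional extending the one given on a unital subspace. -/
theorem exists_positive_extension (S : Submodule ℂ (L →L[ℂ] L)) (hS : 1 ∈ S)
    (Φ : (L →L[ℂ] L) →ₗ[ℂ] (L →L[ℂ] L))
    (hΦ : ∀ (n : ℕ) (c : Fin n → Fin n → L →L[ℂ] L), (∀ i j, c i j ∈ S) → Accretive c →
      Accretive fun i j => Φ (c i j)) :
    ∃ G : ((L × L) →₀ (L →L[ℂ] L)) →ₗ[ℂ] ℂ,
      (∀ c, (∀ p, c p ∈ S) → G c = formalPairing Φ LinearMap.id c) ∧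
      ∀ c ∈ accretiveCone L, 0 ≤ (G c).re := by
  let D : Submodule ℝ ((L × L) →₀ (L →L[ℂ] L)) :=
    { carrier := {c | ∀ p, c p ∈ S}
      add_mem' := fun ha hb p => S.add_mem (ha p) (hb p)
      zero_mem' := fun p => S.zero_mem
      smul_mem' := fun t c hc p => by
        have : (t • c) p = (t : ℂ) • c p := by simp
        rw [this]
        exact S.smul_mem _ (hc p) }
  let F : ((L × L) →₀ (L →L[ℂ] L)) →ₗ[ℝ] ℝ :=
    { toFun := fun c => (formalPairing Φ LinearMap.id c).re
      map_add' := by simp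
      map_smul' := fun t c => by
        have : t • c = (t : ℂ) • c := by ext; simp
        rw [this, map_smul]
        simp }
  obtain ⟨g, hgF, hg⟩ := riesz_extension (accretiveCone L) (F.toPMap D)
    (fun x hx => formalPairing_id_nonneg S Φ hΦ x x.2 hx)
    (fun y => by
      obtain ⟨x, hx, hxy⟩ := exists_add_mem_accretiveCone S hS y
      exact ⟨⟨x, hx⟩, hxy⟩)
  have hgF' : ∀ c, (∀ p, c p ∈ S) → g c = (formalPairing Φ LinearMap.id c).re :=
    fun c hc => hgF ⟨c, hc⟩
  let G : ((L × L) →₀ (L →L[ℂ] L)) →ₗ[ℂ] ℂ := Module.Dual.extendRCLike (𝕜 := ℂ) g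
  have hG : ∀ c, G c = g c - Complex.I * g (Complex.I • c) := fun c => by
    simp [G, Module.Dual.extendRCLike_apply]
  refine ⟨G, fun c hc => ?_, fun c hc => ?_⟩
  · rw [hG, hgF' c hc, hgF' _ (fun p => S.smul_mem _ (hc p)), map_smul]
    apply Complex.ext <;> simp
  · rw [hG]
    simpa using hg c hc

/-- **Arveson's extension theorem** for maps on unital subspaces of `B(L)`. -/
theorem exists_isUCP_extension [CompleteSpace L] (S : Submodule ℂ (L →L[ℂ] L)) (hS : 1 ∈ S)
    (Φ : (L →L[ℂ] L) →ₗ[ℂ] (L →L[ℂ] L)) (hΦ1 : Φ 1 = 1)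
    (hΦ : ∀ (n : ℕ) (c : Fin n → Fin n → L →L[ℂ] L), (∀ i j, c i j ∈ S) → Accretive c →
      Accretive fun i j => Φ (c i j)) :
    ∃ Ψ : (L →L[ℂ] L) →ₗ[ℂ] (L →L[ℂ] L), IsUCP Ψ ∧ ∀ s ∈ S, Ψ s = Φ s := by
  classical
  obtain ⟨G, hGS, hG⟩ := exists_positive_extension S hS Φ hΦ
  -- A formal sum annihilated by every `Z` lies in the cone together with its negative, so `G` kills
  -- it. As each `Z` is linear, the relations expressing sesquilinearity in `(ξ, η)` are of this
  -- kind.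
  have hre : ∀ c, (∀ Z, formalPairing LinearMap.id Z c = 0) → (G c).re = 0 := by
    intro c hc
    have h1 := hG c (fun Z => by simp [hc Z])
    have h2 := hG (-c) (fun Z => by simp [hc Z])
    rw [map_neg, Complex.neg_re] at h2
    linarith
  have hzero : ∀ c, (∀ Z, formalPairing LinearMap.id Z c = 0) → G c = 0 := by
    intro c hc
    have h1 := hre c hc
    have h2 := hre (Complex.I • c) (fun Z => by simp [hc Z])
    rw [map_smul] at h2
    apply Complex.ext
    · simpa using h1
    · simpa using h2
  have hsingle : ∀ s ∈ S, ∀ ξ η, G (Finsupp.single (ξ, η) s) = ⟪ξ, Φ s η⟫_ℂ := by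
    intro s hs ξ η
    rw [hGS]
    · simp
    · intro p
      rw [Finsupp.single_apply]
      split_ifs
      · exact hs
      · exact S.zero_mem
  have hform : IsUCPForm fun a ξ η => G (Finsupp.single (ξ, η) a) := by
    refine ⟨?_, ?_, ?_, ?_, ?_, ?_, ?_, ?_⟩
    · intro a b ξ η
      rw [Finsupp.single_add, map_add]
    · intro t a ξ η
      rw [← Finsupp.smul_single, map_smul, smul_eq_mul]
    · intro a ξ ξ' η
      rw [← map_add, ← sub_eq_zero, ← map_sub]
      exact hzero _ fun Z => by simp
    · intro t a ξ η
      rw [← smul_eq_mul, ← map_smul, ← sub_eq_zero, ← map_sub]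
      exact hzero _ fun Z => by simp [mul_comm]
    · intro a ξ η η'
      rw [← map_add, ← sub_eq_zero, ← map_sub]
      exact hzero _ fun Z => by simp
    · intro t a ξ η
      rw [← smul_eq_mul, ← map_smul, ← sub_eq_zero, ← map_sub]
      exact hzero _ fun Z => by simp
    · intro ξ η
      rw [hsingle 1 hS, hΦ1]
      simp
    · intro n c hc ζ
      have : ∑ i, ∑ j, Finsupp.single (ζ i, ζ j) (c i j) ∈ accretiveCone L := by
        intro Z
        simpa using hc (fun i => Z (ζ i))
      simpa using hG _ this
  obtain ⟨Ψ, hΨ, hΨG⟩ := hform.exists_isUCP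
  refine ⟨Ψ, hΨ, fun s hs => ?_⟩
  ext η
  refine ext_inner_left ℂ fun ξ => ?_
  rw [hΨG, hsingle s hs]

end Extension

/-! ### An idempotent in a compact semigroup of completely positive maps. -/

section Idempotent

variable {L : Type*} [NormedAddCommGroup L] [InnerProductSpace ℂ L]

theorem IsUCP.comp {Φ Ψ : (L →L[ℂ] L) →ₗ[ℂ] (L →L[ℂ] L)} (hΦ : IsUCP Φ) (hΨ : IsUCP Ψ) :
    IsUCP (Φ ∘ₗ Ψ) where
  map_one := by simp [hΦ.map_one, hΨ.map_one]
  accretive n c hc := hΦ.accretive n _ (hΨ.accretive n c hc)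

theorem isClosed_isUCPForm :
    IsClosed {f : (L →L[ℂ] L) × L × L → ℂ | IsUCPForm fun a ξ η => f (a, ξ, η)} := by
  have : {f : (L →L[ℂ] L) × L × L → ℂ | IsUCPForm fun a ξ η => f (a, ξ, η)} =
      {f | (∀ a b ξ η, f (a + b, ξ, η) = f (a, ξ, η) + f (b, ξ, η)) ∧
        (∀ (t : ℂ) a ξ η, f (t • a, ξ, η) = t * f (a, ξ, η)) ∧
        (∀ a ξ ξ' η, f (a, ξ + ξ', η) = f (a, ξ, η) + f (a, ξ', η)) ∧
        (∀ (t : ℂ) a ξ η, f (a, t • ξ, η) = star t * f (a, ξ, η)) ∧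
        (∀ a ξ η η', f (a, ξ, η + η') = f (a, ξ, η) + f (a, ξ, η')) ∧
        (∀ (t : ℂ) a ξ η, f (a, ξ, t • η) = t * f (a, ξ, η)) ∧
        (∀ ξ η, f (1, ξ, η) = ⟪ξ, η⟫_ℂ) ∧
        ∀ (n : ℕ) (c : Fin n → Fin n → L →L[ℂ] L), Accretive c →
          ∀ ζ : Fin n → L, 0 ≤ (∑ i, ∑ j, f (c i j, ζ i, ζ j)).re} := by
    ext f
    exact ⟨fun ⟨h1, h2, h3, h4, h5, h6, h7, h8⟩ => ⟨h1, h2, h3, h4, h5, h6, h7, h8⟩,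
      fun ⟨h1, h2, h3, h4, h5, h6, h7, h8⟩ => ⟨h1, h2, h3, h4, h5, h6, h7, h8⟩⟩
  rw [this]
  simp only [Set.ofPred_and, Set.ofPred_forall]
  repeat' apply IsClosed.inter
  all_goals
    repeat' (apply isClosed_iInter; intro)
  any_goals exact isClosed_eq (by fun_prop) (by fun_prop)
  exact isClosed_le (by fun_prop) (by fun_prop)

/-- The unital completely positive maps with prescribed values on a set form a compact right
topological semigroup, so that it has an idempotent. -/
theorem exists_idempotent_isUCP [CompleteSpace L] (S : Set (L →L[ℂ] L))
    (p : (L →L[ℂ] L) → (L →L[ℂ] L)) (hpS : ∀ s ∈ S, p s ∈ S) (hpp : ∀ s ∈ S, p (p s) = p s)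
    (hex : ∃ Φ : (L →L[ℂ] L) →ₗ[ℂ] (L →L[ℂ] L), IsUCP Φ ∧ ∀ s ∈ S, Φ s = p s) :
    ∃ Φ : (L →L[ℂ] L) →ₗ[ℂ] (L →L[ℂ] L), IsUCP Φ ∧ (∀ s ∈ S, Φ s = p s) ∧
      ∀ a, Φ (Φ a) = Φ a := by
  let T := {Φ : (L →L[ℂ] L) →ₗ[ℂ] (L →L[ℂ] L) // IsUCP Φ ∧ ∀ s ∈ S, Φ s = p s}
  let e : T → (L →L[ℂ] L) × L × L → ℂ := fun Φ q => ⟪q.2.1, Φ.1 q.1 q.2.2⟫_ℂ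
  have he : Function.Injective e := by
    intro Φ Ψ h
    apply Subtype.ext
    ext a η
    refine ext_inner_left ℂ fun ξ => ?_
    exact congrFun h (a, ξ, η)
  let : TopologicalSpace T := TopologicalSpace.induced e inferInstance
  have hind : Topology.IsInducing e := ⟨rfl⟩
  let : Semigroup T :=
    { mul := fun Φ Ψ => ⟨Φ.1 ∘ₗ Ψ.1, Φ.2.1.comp Ψ.2.1, fun s hs => by
        simp [Ψ.2.2 s hs, Φ.2.2 _ (hpS s hs), hpp s hs]⟩
      mul_assoc := fun _ _ _ => rfl }
  have hrange : Set.range e = {f | IsUCPForm fun a ξ η => f (a, ξ, η)} ∩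
      {f | ∀ s ∈ S, ∀ ξ η, f (s, ξ, η) = ⟪ξ, p s η⟫_ℂ} := by
    ext f
    constructor
    · rintro ⟨Φ, rfl⟩
      refine ⟨Φ.2.1.isUCPForm, fun s hs ξ η => ?_⟩
      simp [e, Φ.2.2 s hs]
    · rintro ⟨hf, hfS⟩
      obtain ⟨Φ, hΦ, hΦf⟩ := hf.exists_isUCP
      refine ⟨⟨Φ, hΦ, fun s hs => ?_⟩, ?_⟩
      · ext η
        refine ext_inner_left ℂ fun ξ => ?_
        rw [hΦf, hfS s hs]
      · ext q
        exact hΦf _ _ _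
  -- Tychonoff: the bound `‖f a ξ η‖ ≤ ‖a‖ ‖ξ‖ ‖η‖` puts the range in a product of closed discs, and
  -- all defining conditions are pointwise closed.
  have hcomp : IsCompact (Set.range e) := by
    refine IsCompact.of_isClosed_subset
      (isCompact_univ_pi fun q : (L →L[ℂ] L) × L × L =>
        isCompact_closedBall (0 : ℂ) (‖q.1‖ * ‖q.2.1‖ * ‖q.2.2‖)) ?_ ?_
    · rw [hrange]
      refine isClosed_isUCPForm.inter ?_
      simp only [Set.ofPred_forall]
      repeat' (apply isClosed_iInter; intro)
      exact isClosed_eq (by fun_prop) (by fun_prop)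
    · rw [hrange]
      rintro f ⟨hf, -⟩ q -
      simpa using hf.norm_le q.1 q.2.1 q.2.2
  have : CompactSpace T := by
    rw [← isCompact_univ_iff, hind.isCompact_iff, Set.image_univ]
    exact hcomp
  have : T2Space T := T2Space.of_injective_continuous he hind.continuous
  have : Nonempty T := by
    obtain ⟨Φ, hΦ⟩ := hex
    exact ⟨⟨Φ, hΦ⟩⟩
  -- For fixed `Ψ`, the coordinate of `Φ ∘ Ψ` at `(a, ξ, η)` is that of `Φ` at `(Ψ a, ξ, η)`, so
  -- continuity in the left factor is immediate; continuity in `Ψ` is not needed.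
  obtain ⟨Φ, hΦ⟩ := exists_idempotent_of_compact_t2_of_continuous_mul_left (M := T) (by
    intro Ψ
    rw [hind.continuous_iff, continuous_pi_iff]
    intro q
    exact (continuous_apply (Ψ.1 q.1, q.2.1, q.2.2)).comp hind.continuous)
  exact ⟨Φ.1, Φ.2.1, Φ.2.2, fun a => LinearMap.congr_fun (congrArg Subtype.val hΦ) a⟩

end Idempotent

/-! ### The Stinespring semi-inner product and the Choi–Effros identities. -/

section Dilation

variable {L : Type*} [NormedAddCommGroup L] [InnerProductSpace ℂ L]

/-- Contractive idempotents on a semi-inner product space are symmetric. -/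
theorem inner_map_left_eq_of_contractive_idempotent {V : Type*} [SeminormedAddCommGroup V]
    [InnerProductSpace ℂ V] (E : V →ₗ[ℂ] V) (hE : ∀ x, E (E x) = E x) (hle : ∀ x, ‖E x‖ ≤ ‖x‖)
    (x y : V) : ⟪E x, y⟫_ℂ = ⟪x, E y⟫_ℂ := by
  have key : ∀ x y, ⟪E x, y - E y⟫_ℂ = 0 := by
    intro x y
    set p := E x with hp
    set q := y - E y with hq
    have hEp : E p = p := by rw [hp, hE]
    have hEq : E q = 0 := by rw [hq, map_sub, hE, sub_self]
    set z := ⟪p, q⟫_ℂ with hz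
    by_contra hne
    have hpos : 0 < ‖z‖ ^ 2 := by positivity
    -- `E` fixes `p` and kills `q`, so `‖p‖ ≤ ‖p + t q‖` for all scalars `t`; a small `t` in the
    -- direction of `-star z` contradicts this unless `z = 0`. The `+ 1` covers `‖q‖ = 0`.
    set ε : ℝ := 1 / (‖q‖ ^ 2 + 1) with hε
    have hε0 : 0 < ε := by positivity
    have hε1 : ε * ‖q‖ ^ 2 ≤ 1 := by
      rw [hε, one_div, inv_mul_le_iff₀ (by positivity)]
      linarith
    have h1 := hle (p + (-(ε : ℂ) * star z) • q)
    rw [map_add, map_smul, hEp, hEq, smul_zero, add_zero] at h1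
    have h2 : ‖p‖ ^ 2 ≤ ‖p + (-(ε : ℂ) * star z) • q‖ ^ 2 := by gcongr
    rw [@norm_add_sq ℂ, inner_smul_right, norm_smul, ← hz] at h2
    have h3 : RCLike.re (-(ε : ℂ) * star z * z) = -(ε * ‖z‖ ^ 2) := by
      have : star z * z = ((‖z‖ ^ 2 : ℝ) : ℂ) := by
        rw [Complex.ofReal_pow, ← Complex.conj_mul', starRingEnd_apply]
      rw [mul_assoc, this, ← Complex.ofReal_neg, ← Complex.ofReal_mul, neg_mul]
      exact Complex.ofReal_re _
    rw [h3] at h2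
    simp only [norm_mul, norm_neg, norm_star, Complex.norm_real, Real.norm_eq_abs,
      abs_of_pos hε0] at h2
    have h4 : (ε * ‖z‖ * ‖q‖) ^ 2 = ε * ‖z‖ ^ 2 * (ε * ‖q‖ ^ 2) := by ring
    rw [h4] at h2
    have h5 : ε * ‖z‖ ^ 2 * (ε * ‖q‖ ^ 2) ≤ ε * ‖z‖ ^ 2 * 1 := by gcongr
    have h6 : 0 < ε * ‖z‖ ^ 2 := by positivity
    linarith
  have h1 := key x y
  have h2 := key y x
  rw [inner_sub_right, sub_eq_zero] at h1 h2
  rw [h1, ← inner_conj_symm (E x) (E y), ← h2, inner_conj_symm]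

variable {Φ : (L →L[ℂ] L) →ₗ[ℂ] (L →L[ℂ] L)}

/-- The algebraic tensor product `B(L) ⊗ L`, presented by formal sums `∑ a_ξ ⊗ ξ`, on which a
completely positive map defines a semi-inner product. -/
def PreDilation (_hΦ : IsUCP Φ) : Type _ := L →₀ (L →L[ℂ] L)

namespace PreDilation

variable (hΦ : IsUCP Φ)

instance : AddCommGroup (PreDilation hΦ) := inferInstanceAs (AddCommGroup (L →₀ (L →L[ℂ] L)))
instance : Module ℂ (PreDilation hΦ) := inferInstanceAs (Module ℂ (L →₀ (L →L[ℂ] L)))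

/-- The linear equivalence with formal sums. -/
def equiv : PreDilation hΦ ≃ₗ[ℂ] (L →₀ (L →L[ℂ] L)) := LinearEquiv.refl ℂ _

/-- The elementary tensor `a ⊗ ξ`. -/
def tmul (a : L →L[ℂ] L) (ξ : L) : PreDilation hΦ := (equiv hΦ).symm (Finsupp.single ξ a)

/-- The map `a ⊗ ξ ↦ f a ⊗ ξ`. -/
def mapOp (f : (L →L[ℂ] L) →ₗ[ℂ] (L →L[ℂ] L)) : PreDilation hΦ →ₗ[ℂ] PreDilation hΦ :=
  (equiv hΦ).symm.toLinearMap ∘ₗ Finsupp.mapRange.linearMap f ∘ₗ (equiv hΦ).toLinearMap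

theorem equiv_mapOp (f : (L →L[ℂ] L) →ₗ[ℂ] (L →L[ℂ] L)) (u : PreDilation hΦ) (ξ : L) :
    equiv hΦ (mapOp hΦ f u) ξ = f (equiv hΦ u ξ) := by
  simp [mapOp]

theorem ext_equiv {u v : PreDilation hΦ} (h : ∀ ξ, equiv hΦ u ξ = equiv hΦ v ξ) : u = v :=
  (equiv hΦ).injective (Finsupp.ext h)

theorem mapOp_tmul (f : (L →L[ℂ] L) →ₗ[ℂ] (L →L[ℂ] L)) (a : L →L[ℂ] L) (ξ : L) :
    mapOp hΦ f (tmul hΦ a ξ) = tmul hΦ (f a) ξ := by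
  simp [mapOp, tmul]

theorem support_mapOp (f : (L →L[ℂ] L) →ₗ[ℂ] (L →L[ℂ] L)) (u : PreDilation hΦ) :
    (equiv hΦ (mapOp hΦ f u)).support ⊆ (equiv hΦ u).support := by
  intro ξ
  simp only [Finsupp.mem_support_iff, equiv_mapOp]
  exact fun h h' => h (by rw [h', map_zero])

end PreDilation

variable [CompleteSpace L]

theorem re_inner_star (a : L →L[ℂ] L) (ζ : L) : (⟪ζ, star a ζ⟫_ℂ).re = (⟪ζ, a ζ⟫_ℂ).re := by
  rw [ContinuousLinearMap.star_eq_adjoint, ContinuousLinearMap.adjoint_inner_right,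
    ← inner_conj_symm, Complex.conj_re]

/-- Both `star a - a` and its negative are accretive, being skew-adjoint, and `Φ` preserves this. -/
theorem IsUCP.re_inner_map_star (hΦ : IsUCP Φ) (a : L →L[ℂ] L) (ζ : L) :
    (⟪ζ, Φ (star a) ζ⟫_ℂ).re = (⟪ζ, Φ a ζ⟫_ℂ).re := by
  have h : ∀ b : L →L[ℂ] L, (∀ ζ, 0 ≤ (⟪ζ, b ζ⟫_ℂ).re) → 0 ≤ (⟪ζ, Φ b ζ⟫_ℂ).re := by
    intro b hb
    simpa using hΦ.map_accretive (c := fun _ _ : Unit => b) (fun ζ => by simpa using hb (ζ ()))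
      (fun _ => ζ)
  have h1 := h (star a - a) (fun ζ => by simp [re_inner_star])
  have h2 := h (a - star a) (fun ζ => by simp [re_inner_star])
  simp only [map_sub, sub_apply, inner_sub_right, Complex.sub_re] at h1 h2
  linarith

/-- The preceding lemma for `a` and `I • a` gives real and imaginary parts of the quadratic form,
which determines an operator over `ℂ`. -/
theorem IsUCP.map_star (hΦ : IsUCP Φ) (a : L →L[ℂ] L) : Φ (star a) = star (Φ a) := by
  have h : ∀ ζ, ⟪ζ, Φ (star a) ζ⟫_ℂ = ⟪ζ, star (Φ a) ζ⟫_ℂ := by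
    intro ζ
    have h1 := hΦ.re_inner_map_star a ζ
    have h2 := hΦ.re_inner_map_star (Complex.I • a) ζ
    have h3 := re_inner_star (Φ a) ζ
    have h4 := re_inner_star (Complex.I • Φ a) ζ
    simp only [star_smul, map_smul, smul_apply, inner_smul_right] at h2 h4
    simp at h2 h4
    apply Complex.ext <;> linarith
  apply ContinuousLinearMap.coe_injective
  rw [← ext_inner_map]
  intro ζ
  have := congrArg (starRingEnd ℂ) (h ζ)
  rwa [inner_conj_symm, inner_conj_symm] at this

namespace PreDilation

variable (hΦ : IsUCP Φ)

/-- The semi-inner product `⟨a ⊗ ξ, b ⊗ η⟩ = ⟪ξ, Φ (a* b) η⟫`. -/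
def form (u v : PreDilation hΦ) : ℂ :=
  (equiv hΦ u).sum fun ξ a => (equiv hΦ v).sum fun η b => ⟪ξ, Φ (star a * b) η⟫_ℂ

theorem form_eq_sum [DecidableEq L] (u v : PreDilation hΦ) (s : Finset L)
    (hu : (equiv hΦ u).support ⊆ s) (hv : (equiv hΦ v).support ⊆ s) :
    form hΦ u v = ∑ ξ ∈ s, ∑ η ∈ s, ⟪ξ, Φ (star (equiv hΦ u ξ) * equiv hΦ v η) η⟫_ℂ := by
  unfold form
  rw [Finsupp.sum_of_support_subset _ hu _ (by simp)]
  refine Finset.sum_congr rfl fun ξ _ => ?_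
  rw [Finsupp.sum_of_support_subset _ hv _ (by simp)]

theorem sum_inner_star_mul {κ : Type*} (s : Finset κ) (a b : κ → L →L[ℂ] L) (ζ : κ → L) :
    ∑ i ∈ s, ∑ j ∈ s, ⟪ζ i, (star (a i) * b j) (ζ j)⟫_ℂ =
      ⟪∑ i ∈ s, a i (ζ i), ∑ j ∈ s, b j (ζ j)⟫_ℂ := by
  simp only [sum_inner, inner_sum]
  rw [Finset.sum_comm]
  simp [ContinuousLinearMap.star_eq_adjoint, ContinuousLinearMap.adjoint_inner_right]

theorem form_self_nonneg (u : PreDilation hΦ) : 0 ≤ (form hΦ u u).re := by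
  classical
  rw [form_eq_sum hΦ u u _ subset_rfl subset_rfl]
  refine hΦ.sum_nonneg _ (fun ξ η => star (equiv hΦ u ξ) * equiv hΦ u η) (fun ζ => ?_) _
  rw [sum_inner_star_mul]
  exact inner_self_nonneg (𝕜 := ℂ)

/-- The semi-inner product space structure. -/
abbrev core : PreInnerProductSpace.Core ℂ (PreDilation hΦ) where
  inner := form hΦ
  conj_inner_symm u v := by
    classical
    rw [form_eq_sum hΦ u v _ Finset.subset_union_left Finset.subset_union_right,
      form_eq_sum hΦ v u _ Finset.subset_union_right Finset.subset_union_left]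
    rw [Finset.sum_comm]
    simp only [map_sum]
    refine Finset.sum_congr rfl fun ξ _ => Finset.sum_congr rfl fun η _ => ?_
    rw [inner_conj_symm, ← ContinuousLinearMap.adjoint_inner_right,
      ← ContinuousLinearMap.star_eq_adjoint, ← hΦ.map_star]
    simp
  re_inner_nonneg := form_self_nonneg hΦ
  add_left u v w := by
    unfold form
    rw [map_add, Finsupp.sum_add_index' (by simp)]
    intro ξ a b
    simp [add_mul, Finsupp.sum_add]
  smul_left u v t := by
    unfold form
    rw [map_smul, Finsupp.sum_smul_index' (by simp), Finsupp.mul_sum]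
    refine Finsupp.sum_congr fun ξ _ => ?_
    simp [Finsupp.mul_sum]

instance : SeminormedAddCommGroup (PreDilation hΦ) :=
  InnerProductSpace.Core.toSeminormedAddCommGroup (c := core hΦ)
instance : InnerProductSpace ℂ (PreDilation hΦ) := InnerProductSpace.ofCore (core hΦ)

theorem inner_eq_form (u v : PreDilation hΦ) : ⟪u, v⟫_ℂ = form hΦ u v := rfl

theorem norm_sq_eq (u : PreDilation hΦ) : ‖u‖ ^ 2 = (form hΦ u u).re := by
  rw [← inner_eq_form]
  exact norm_sq_eq_re_inner (𝕜 := ℂ) u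

theorem inner_tmul (a b : L →L[ℂ] L) (ξ η : L) :
    ⟪tmul hΦ a ξ, tmul hΦ b η⟫_ℂ = ⟪ξ, Φ (star a * b) η⟫_ℂ := by
  simp [inner_eq_form, form, tmul]

/-- Left multiplication by a matrix of operators is bounded by the norm of the matrix. -/
theorem sum_norm_sq_mulLeft_le {ι : Type*} [Fintype ι] (x : ι → ι → L →L[ℂ] L) (C : ℝ)
    (hx : ∀ ζ : ι → L, ∑ i, ‖∑ j, x i j (ζ j)‖ ^ 2 ≤ C * ∑ j, ‖ζ j‖ ^ 2)
    (y : ι → PreDilation hΦ) :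
    ∑ i, ‖∑ j, mapOp hΦ (LinearMap.mulLeft ℂ (x i j)) (y j)‖ ^ 2 ≤ C * ∑ j, ‖y j‖ ^ 2 := by
  classical
  let s : Finset L := Finset.univ.biUnion fun j => (equiv hΦ (y j)).support
  have hs : ∀ j, (equiv hΦ (y j)).support ⊆ s := fun j =>
    Finset.subset_biUnion_of_mem (fun j => (equiv hΦ (y j)).support) (Finset.mem_univ j)
  have hval : ∀ i ξ, equiv hΦ (∑ j, mapOp hΦ (LinearMap.mulLeft ℂ (x i j)) (y j)) ξ =
      ∑ j, x i j * equiv hΦ (y j) ξ := by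
    intro i ξ
    simp [Finsupp.finsetSum_apply, equiv_mapOp]
  have hs' : ∀ i, (equiv hΦ (∑ j, mapOp hΦ (LinearMap.mulLeft ℂ (x i j)) (y j))).support ⊆ s := by
    intro i ξ hξ
    by_contra hns
    rw [Finsupp.mem_support_iff, hval] at hξ
    refine hξ (Finset.sum_eq_zero fun j _ => ?_)
    have : equiv hΦ (y j) ξ = 0 := Finsupp.notMem_support_iff.1 fun h => hns (hs j h)
    rw [this, mul_zero]
  -- The kernel `C y* y - (x y)* (x y)` is positive by `hx`. Applying `Φ` to it gives exactly the
  -- difference of the two sides.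
  let c : L → L → L →L[ℂ] L := fun ξ η =>
    (C : ℂ) • (∑ j, star (equiv hΦ (y j) ξ) * equiv hΦ (y j) η) -
      ∑ i, star (∑ j, x i j * equiv hΦ (y j) ξ) * ∑ j, x i j * equiv hΦ (y j) η
  have hcsum : ∀ (Ψ : (L →L[ℂ] L) →ₗ[ℂ] (L →L[ℂ] L)) (ζ : L → L),
      ∑ ξ ∈ s, ∑ η ∈ s, ⟪ζ ξ, Ψ (c ξ η) (ζ η)⟫_ℂ =
      C * (∑ j, ∑ ξ ∈ s, ∑ η ∈ s,
          ⟪ζ ξ, Ψ (star (equiv hΦ (y j) ξ) * equiv hΦ (y j) η) (ζ η)⟫_ℂ) -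
        ∑ i, ∑ ξ ∈ s, ∑ η ∈ s, ⟪ζ ξ, Ψ (star (∑ j, x i j * equiv hΦ (y j) ξ) *
          ∑ j, x i j * equiv hΦ (y j) η) (ζ η)⟫_ℂ := by
    intro Ψ ζ
    simp only [c, map_sub, map_smul, map_sum Ψ, sub_apply, smul_apply, sum_apply,
      inner_sub_right, inner_smul_right, inner_sum, Finset.sum_sub_distrib, Finset.mul_sum]
    congr 1
    · conv_rhs => rw [Finset.sum_comm]
      refine Finset.sum_congr rfl fun ξ _ => ?_
      rw [Finset.sum_comm]
    · conv_rhs => rw [Finset.sum_comm]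
      refine Finset.sum_congr rfl fun ξ _ => ?_
      rw [Finset.sum_comm]
  have hpos := hΦ.sum_nonneg s c (fun ζ => by
    have h := hcsum LinearMap.id ζ
    simp only [LinearMap.id_apply, sum_inner_star_mul] at h
    rw [h]
    have h' := hx (fun j => ∑ ξ ∈ s, equiv hΦ (y j) ξ (ζ ξ))
    simp only [Complex.sub_re, Complex.re_ofReal_mul, Complex.re_sum]
    have h1 : ∀ w : L, (⟪w, w⟫_ℂ).re = ‖w‖ ^ 2 := fun w => (norm_sq_eq_re_inner (𝕜 := ℂ) w).symm
    simp only [h1]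
    have h2 : ∀ i, ∑ ξ ∈ s, (∑ j, x i j * equiv hΦ (y j) ξ) (ζ ξ) =
        ∑ j, x i j (∑ ξ ∈ s, equiv hΦ (y j) ξ (ζ ξ)) := by
      intro i
      simp only [sum_apply, map_sum, mul_apply_eq_comp]
      rw [Finset.sum_comm]
    simp only [h2]
    linarith) id
  rw [show (∑ ξ ∈ s, ∑ η ∈ s, ⟪id ξ, Φ (c ξ η) (id η)⟫_ℂ) = _ from hcsum Φ id] at hpos
  simp only [norm_sq_eq, form_eq_sum hΦ _ _ s (hs _) (hs _), form_eq_sum hΦ _ _ s (hs' _) (hs' _),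
    hval]
  simp only [Complex.sub_re, Complex.re_ofReal_mul, Complex.re_sum, id] at hpos ⊢
  linarith

variable {hΦ}

/-- Kadison–Schwarz: an idempotent completely positive map acts contractively. -/
theorem norm_mapOp_le (hid : ∀ a, Φ (Φ a) = Φ a) (u : PreDilation hΦ) :
    ‖mapOp hΦ Φ u‖ ≤ ‖u‖ := by
  classical
  rw [← sq_le_sq₀ (norm_nonneg _) (norm_nonneg _)]
  let s := (equiv hΦ u).support
  let b : L → L →L[ℂ] L := fun ξ => equiv hΦ u ξ
  have schwarz : ∀ ζ : L → L,
      0 ≤ (∑ ξ ∈ s, ∑ η ∈ s, ⟪ζ ξ, (Φ (star (b ξ) * b η) - star (Φ (b ξ)) * Φ (b η)) (ζ η)⟫_ℂ).re := by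
    intro ζ
    -- Schwarz inequality by completing the square: adjoin the operator `1` to the family `b` and
    -- test at the vector `-∑ Φ (b η) (ζ η)` in the new slot.
    let o : Option L → L →L[ℂ] L := fun k => k.elim 1 b
    have h := hΦ.sum_nonneg (Finset.insertNone s) (fun k l => star (o k) * o l)
      (fun ω => by
        rw [sum_inner_star_mul]
        exact inner_self_nonneg (𝕜 := ℂ))
      (fun k => k.elim (-∑ η ∈ s, Φ (b η) (ζ η)) ζ)
    simp only [Finset.sum_insertNone, o, Option.elim, star_one, one_mul, mul_one, hΦ.map_one,
      hΦ.map_star] at h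
    have h1 := sum_inner_star_mul s (fun ξ => Φ (b ξ)) (fun ξ => Φ (b ξ)) ζ
    simp only [sub_apply, inner_sub_right, Finset.sum_sub_distrib, h1]
    rw [Finset.sum_add_distrib] at h
    have h2 : ∑ ξ ∈ s, ⟪ζ ξ, star (Φ (b ξ)) (-∑ η ∈ s, Φ (b η) (ζ η))⟫_ℂ =
        -⟪∑ η ∈ s, Φ (b η) (ζ η), ∑ η ∈ s, Φ (b η) (ζ η)⟫_ℂ := by
      simp only [ContinuousLinearMap.star_eq_adjoint, ContinuousLinearMap.adjoint_inner_right]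
      rw [← sum_inner, inner_neg_right]
    have h3 : ∑ ξ ∈ s, ⟪-∑ η ∈ s, Φ (b η) (ζ η), Φ (b ξ) (ζ ξ)⟫_ℂ =
        -⟪∑ η ∈ s, Φ (b η) (ζ η), ∑ η ∈ s, Φ (b η) (ζ η)⟫_ℂ := by
      rw [← inner_sum, inner_neg_left]
    rw [h2, h3] at h
    simp only [one_apply_eq_self, inner_neg_neg] at h
    convert h using 2
    ring
  -- A second application of `Φ` gives `Φ (Φ b* Φ b) ≤ Φ (Φ (b* b))`, and idempotence reduces the
  -- right side to `Φ (b* b)`.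
  have hpos := hΦ.sum_nonneg s
    (fun ξ η => Φ (star (b ξ) * b η) - star (Φ (b ξ)) * Φ (b η)) schwarz id
  rw [norm_sq_eq, norm_sq_eq, form_eq_sum hΦ u u s subset_rfl subset_rfl,
    form_eq_sum hΦ _ _ s (support_mapOp hΦ Φ u) (support_mapOp hΦ Φ u)]
  simp only [equiv_mapOp]
  simp only [map_sub, hid, sub_apply, inner_sub_right, Finset.sum_sub_distrib, Complex.sub_re,
    id] at hpos
  linarith

theorem inner_mapOp_left (hid : ∀ a, Φ (Φ a) = Φ a) (u v : PreDilation hΦ) :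
    ⟪mapOp hΦ Φ u, v⟫_ℂ = ⟪u, mapOp hΦ Φ v⟫_ℂ :=
  inner_map_left_eq_of_contractive_idempotent _
    (fun u => ext_equiv hΦ fun ξ => by simp [equiv_mapOp, hid]) (norm_mapOp_le hid) u v

theorem inner_mulLeft_left (T : L →L[ℂ] L) (u v : PreDilation hΦ) :
    ⟪mapOp hΦ (LinearMap.mulLeft ℂ T) u, v⟫_ℂ =
      ⟪u, mapOp hΦ (LinearMap.mulLeft ℂ (star T)) v⟫_ℂ := by
  classical
  rw [inner_eq_form, inner_eq_form,
    form_eq_sum hΦ _ _ ((equiv hΦ u).support ∪ (equiv hΦ v).support)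
      ((support_mapOp hΦ _ u).trans Finset.subset_union_left) Finset.subset_union_right,
    form_eq_sum hΦ _ _ ((equiv hΦ u).support ∪ (equiv hΦ v).support) Finset.subset_union_left
      ((support_mapOp hΦ _ v).trans Finset.subset_union_right)]
  simp [equiv_mapOp, mul_assoc]

end PreDilation

open PreDilation

/-- This is the self-adjointness of `Φ ⊗ id`, read off at the elementary tensors `a* ⊗ ξ` and `b ⊗
η`. -/
theorem IsUCP.map_map_mul (hΦ : IsUCP Φ) (hid : ∀ a, Φ (Φ a) = Φ a) (a b : L →L[ℂ] L) :
    Φ (Φ a * b) = Φ (a * Φ b) := by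
  ext η
  refine ext_inner_left ℂ fun ξ => ?_
  have := inner_mapOp_left (hΦ := hΦ) hid (tmul hΦ (star a) ξ) (tmul hΦ b η)
  rw [mapOp_tmul, mapOp_tmul, inner_tmul, inner_tmul, hΦ.map_star] at this
  simpa using this

/-- The **Choi–Effros** identity. -/
theorem IsUCP.map_mul_map (hΦ : IsUCP Φ) (hid : ∀ a, Φ (Φ a) = Φ a) {a : L →L[ℂ] L}
    (ha : Φ a = a) (b : L →L[ℂ] L) : Φ (a * Φ b) = Φ (a * b) := by
  rw [← hΦ.map_map_mul hid, ha]

theorem IsUCP.map_map_mul_right (hΦ : IsUCP Φ) (hid : ∀ a, Φ (Φ a) = Φ a) {b : L →L[ℂ] L}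
    (hb : Φ b = b) (a : L →L[ℂ] L) : Φ (Φ a * b) = Φ (a * b) := by
  rw [hΦ.map_map_mul hid, hb]

end Dilation

/-! ### Matrix norms as bounds on families of vectors. -/

section MatrixNorm

variable {H K : Type*} [NormedAddCommGroup H] [InnerProductSpace ℂ H]
  [NormedAddCommGroup K] [InnerProductSpace ℂ K] {n : ℕ}

theorem sum_norm_sq_le_matrixOp (a : Matrix (Fin n) (Fin n) (H →L[ℂ] K)) (ζ : Fin n → H) :
    ∑ i, ‖∑ j, a i j (ζ j)‖ ^ 2 ≤ ‖matrixOp a‖ ^ 2 * ∑ j, ‖ζ j‖ ^ 2 := by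
  have h := (matrixOp a).le_opNorm (WithLp.toLp 2 ζ)
  have h2 := pow_le_pow_left₀ (norm_nonneg _) h 2
  rw [mul_pow, PiLp.norm_sq_eq_of_L2, PiLp.norm_sq_eq_of_L2] at h2
  simpa only [matrixOp_apply] using h2

theorem norm_matrixOp_le (a : Matrix (Fin n) (Fin n) (H →L[ℂ] K)) {C : ℝ} (hC : 0 ≤ C)
    (h : ∀ ζ : Fin n → H, ∑ i, ‖∑ j, a i j (ζ j)‖ ^ 2 ≤ C ^ 2 * ∑ j, ‖ζ j‖ ^ 2) :
    ‖matrixOp a‖ ≤ C := by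
  refine ContinuousLinearMap.opNorm_le_bound _ hC fun x => ?_
  rw [← sq_le_sq₀ (norm_nonneg _) (by positivity), mul_pow, PiLp.norm_sq_eq_of_L2,
    PiLp.norm_sq_eq_of_L2]
  simpa only [matrixOp_apply] using h x

theorem norm_matrixOp_fin_one (a : H →L[ℂ] K) :
    ‖matrixOp (fun _ _ : Fin 1 => a : Matrix (Fin 1) (Fin 1) (H →L[ℂ] K))‖ = ‖a‖ := by
  apply le_antisymm
  · refine norm_matrixOp_le _ (norm_nonneg _) fun ζ => ?_
    simp only [Finset.univ_unique, Finset.sum_singleton, ← mul_pow]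
    gcongr
    exact a.le_opNorm _
  · refine a.opNorm_le_bound (ContinuousLinearMap.opNorm_nonneg _) fun x => ?_
    have := sum_norm_sq_le_matrixOp (fun _ _ : Fin 1 => a) (fun _ => x)
    simp only [Finset.univ_unique, Finset.sum_singleton, ← mul_pow] at this
    exact le_of_sq_le_sq this (by positivity)

end MatrixNorm

/-! ### The representation of the range of `Φ` on the dilation space. -/

section Representation

open PreDilation UniformSpace

variable {L : Type*} [NormedAddCommGroup L] [InnerProductSpace ℂ L]
  {Φ : (L →L[ℂ] L) →ₗ[ℂ] (L →L[ℂ] L)} {hΦ : IsUCP Φ}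

/-- The compression `b ⊗ ξ ↦ Φ (T Φ(b)) ⊗ ξ` of left multiplication by `T`. -/
def compressedMul (hΦ : IsUCP Φ) (T : L →L[ℂ] L) : PreDilation hΦ →ₗ[ℂ] PreDilation hΦ :=
  mapOp hΦ Φ ∘ₗ mapOp hΦ (LinearMap.mulLeft ℂ T) ∘ₗ mapOp hΦ Φ

theorem equiv_compressedMul (T : L →L[ℂ] L) (u : PreDilation hΦ) (ξ : L) :
    equiv hΦ (compressedMul hΦ T u) ξ = Φ (T * Φ (equiv hΦ u ξ)) := by
  simp [compressedMul, equiv_mapOp]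

variable [CompleteSpace L]

/-- The Hilbert space of the dilation. -/
abbrev Dilation (hΦ : IsUCP Φ) : Type _ := Completion (PreDilation hΦ)

theorem sum_norm_sq_compressedMul_le (hid : ∀ a, Φ (Φ a) = Φ a)
    {ι : Type*} [Fintype ι] (x : ι → ι → L →L[ℂ] L) {C : ℝ} (hC : 0 ≤ C)
    (hx : ∀ ζ : ι → L, ∑ i, ‖∑ j, x i j (ζ j)‖ ^ 2 ≤ C * ∑ j, ‖ζ j‖ ^ 2)
    (y : ι → PreDilation hΦ) :
    ∑ i, ‖∑ j, compressedMul hΦ (x i j) (y j)‖ ^ 2 ≤ C * ∑ j, ‖y j‖ ^ 2 := by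
  calc ∑ i, ‖∑ j, compressedMul hΦ (x i j) (y j)‖ ^ 2
      ≤ ∑ i, ‖∑ j, mapOp hΦ (LinearMap.mulLeft ℂ (x i j)) (mapOp hΦ Φ (y j))‖ ^ 2 := by
        gcongr with i
        simp only [compressedMul, LinearMap.comp_apply, ← map_sum]
        exact norm_mapOp_le hid _
    _ ≤ C * ∑ j, ‖mapOp hΦ Φ (y j)‖ ^ 2 := sum_norm_sq_mulLeft_le hΦ x C hx _
    _ ≤ C * ∑ j, ‖y j‖ ^ 2 := by
        gcongr with j
        exact norm_mapOp_le hid _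

theorem norm_compressedMul_le (hid : ∀ a, Φ (Φ a) = Φ a) (T : L →L[ℂ] L)
    (u : PreDilation hΦ) :
    ‖compressedMul hΦ T u‖ ≤ ‖T‖ * ‖u‖ := by
  have := sum_norm_sq_compressedMul_le (hΦ := hΦ) hid (fun _ _ : Unit => T) (C := ‖T‖ ^ 2)
    (by positivity) (fun ζ => by
      simp only [Finset.univ_unique, Finset.sum_singleton, ← mul_pow]
      gcongr
      exact T.le_opNorm _) (fun _ => u)
  simp only [Finset.univ_unique, Finset.sum_singleton, ← mul_pow] at this
  exact le_of_sq_le_sq this (by positivity)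

/-- The representation of the range of `Φ` on the dilation space. -/
def rep (hid : ∀ a, Φ (Φ a) = Φ a) (T : L →L[ℂ] L) : Dilation hΦ →L[ℂ] Dilation hΦ :=
  ((compressedMul hΦ T).mkContinuous ‖T‖ (norm_compressedMul_le hid T)).completion

theorem rep_coe (hid : ∀ a, Φ (Φ a) = Φ a) (T : L →L[ℂ] L)
    (u : PreDilation hΦ) :
    rep hid T (u : Dilation hΦ) = (compressedMul hΦ T u : Dilation hΦ) := by
  simp [rep]

theorem dilation_ext {f g : Dilation hΦ →L[ℂ] Dilation hΦ}
    (h : ∀ u : PreDilation hΦ, f (u : Dilation hΦ) = g (u : Dilation hΦ)) : f = g := by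
  ext x
  induction x using Completion.induction_on with
  | hp => exact isClosed_eq f.continuous g.continuous
  | ih u => exact h u

/-- The representation as a linear map. -/
def repLinear (hΦ : IsUCP Φ) (hid : ∀ a, Φ (Φ a) = Φ a) :
    (L →L[ℂ] L) →ₗ[ℂ] (Dilation hΦ →L[ℂ] Dilation hΦ) where
  toFun := rep hid
  map_add' S T := dilation_ext fun u => by
    rw [add_apply, rep_coe, rep_coe, rep_coe, ← Completion.coe_add]
    congr 1
    exact ext_equiv hΦ fun ξ => by simp [equiv_compressedMul, add_mul]
  map_smul' t T := dilation_ext fun u => by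
    rw [RingHom.id_apply, smul_apply, rep_coe, rep_coe, ← Completion.coe_smul]
    congr 1
    exact ext_equiv hΦ fun ξ => by simp [equiv_compressedMul]

theorem repLinear_coe (hid : ∀ a, Φ (Φ a) = Φ a) (T : L →L[ℂ] L)
    (u : PreDilation hΦ) :
    repLinear hΦ hid T (u : Dilation hΦ) = (compressedMul hΦ T u : Dilation hΦ) :=
  rep_coe hid T u

/-- On `b ⊗ ξ` both sides have operator part `Φ (x y Φ b)`: Choi–Effros removes the inner `Φ` on the
left because `x` is fixed, and on the right because `Φ b` is. -/
theorem repLinear_mul (hid : ∀ a, Φ (Φ a) = Φ a) {x y : L →L[ℂ] L} (hx : Φ x = x) :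
    repLinear hΦ hid x * repLinear hΦ hid y = repLinear hΦ hid (Φ (x * y)) := by
  refine dilation_ext fun u => ?_
  rw [mul_apply_eq_comp, repLinear_coe, repLinear_coe, repLinear_coe]
  congr 1
  refine ext_equiv hΦ fun ξ => ?_
  simp only [equiv_compressedMul, hid]
  rw [hΦ.map_mul_map hid hx, hΦ.map_map_mul_right hid (hid _), mul_assoc]

theorem star_repLinear (hid : ∀ a, Φ (Φ a) = Φ a) (T : L →L[ℂ] L) :
    star (repLinear hΦ hid T) = repLinear hΦ hid (star T) := by
  rw [ContinuousLinearMap.star_eq_adjoint, eq_comm, ContinuousLinearMap.eq_adjoint_iff]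
  intro x y
  induction x, y using Completion.induction_on₂ with
  | hp => exact isClosed_eq (by fun_prop) (by fun_prop)
  | ih u v =>
    rw [repLinear_coe, repLinear_coe, Completion.inner_coe, Completion.inner_coe]
    simp only [compressedMul, LinearMap.comp_apply]
    rw [inner_mapOp_left hid, inner_mulLeft_left, inner_mapOp_left hid, star_star]

theorem norm_matrixOp_repLinear_le {n : ℕ} (hid : ∀ a, Φ (Φ a) = Φ a)
    (x : Matrix (Fin n) (Fin n) (L →L[ℂ] L)) :
    ‖matrixOp (x.map (repLinear hΦ hid))‖ ≤ ‖matrixOp x‖ := by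
  refine norm_matrixOp_le _ (norm_nonneg _) fun ζ => ?_
  have hd : DenseRange (Pi.map fun (_ : Fin n) (u : PreDilation hΦ) => (u : Dilation hΦ)) :=
    DenseRange.piMap fun _ => Completion.denseRange_coe
  induction ζ using hd.induction_on with
  | hp => exact isClosed_le (by fun_prop) (by fun_prop)
  | ih y =>
    simp only [Matrix.map_apply, Pi.map_apply, repLinear_coe]
    have := sum_norm_sq_compressedMul_le (hΦ := hΦ) hid x (by positivity)
      (sum_norm_sq_le_matrixOp x) y
    have hsum : ∀ i, ∑ j, (compressedMul hΦ (x i j) (y j) : Dilation hΦ) =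
        ((∑ j, compressedMul hΦ (x i j) (y j) : PreDilation hΦ) : Dilation hΦ) :=
      fun i => (map_sum (Completion.toCompl : PreDilation hΦ →+ Dilation hΦ) _ _).symm
    simpa only [hsum, Completion.norm_coe] using this

theorem norm_tmul_one (ξ : L) : ‖tmul hΦ 1 ξ‖ = ‖ξ‖ := by
  rw [← sq_eq_sq₀ (norm_nonneg _) (norm_nonneg _), @norm_sq_eq_re_inner ℂ, inner_tmul,
    @norm_sq_eq_re_inner ℂ L]
  simp [hΦ.map_one]

/-- For the lower bound, `ξ ↦ 1 ⊗ ξ` embeds `L` isometrically, and the compression of the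
representation of `x` to this copy of `L` is `Φ x = x`. -/
theorem norm_matrixOp_repLinear {n : ℕ} (hid : ∀ a, Φ (Φ a) = Φ a)
    (x : Matrix (Fin n) (Fin n) (L →L[ℂ] L))
    (hx : ∀ i j, Φ (x i j) = x i j) :
    ‖matrixOp (x.map (repLinear hΦ hid))‖ = ‖matrixOp x‖ := by
  refine le_antisymm (norm_matrixOp_repLinear_le hid x) ?_
  refine norm_matrixOp_le _ (norm_nonneg _) fun ζ => ?_
  have h := sum_norm_sq_le_matrixOp (x.map (repLinear hΦ hid))
    (fun j => (tmul hΦ 1 (ζ j) : Dilation hΦ))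
  simp only [Completion.norm_coe, norm_tmul_one, Matrix.map_apply] at h
  refine le_trans ?_ h
  gcongr with i
  set w := ∑ j, x i j (ζ j) with hw
  set W := ∑ j, repLinear hΦ hid (x i j) (tmul hΦ 1 (ζ j) : Dilation hΦ) with hW
  have h1 : ⟪(tmul hΦ 1 w : Dilation hΦ), W⟫_ℂ = ⟪w, w⟫_ℂ := by
    rw [hW, inner_sum]
    conv_rhs => rw [hw, inner_sum, ← hw]
    refine Finset.sum_congr rfl fun j _ => ?_
    rw [repLinear_coe, Completion.inner_coe]
    simp only [compressedMul, LinearMap.comp_apply, mapOp_tmul, inner_tmul]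
    simp [hΦ.map_one, hx]
  have h2 := norm_inner_le_norm (𝕜 := ℂ) (tmul hΦ 1 w : Dilation hΦ) W
  rw [h1, Completion.norm_coe, norm_tmul_one, inner_self_eq_norm_sq_to_K] at h2
  simp only [norm_pow, RCLike.norm_ofReal, abs_norm] at h2
  by_cases hw0 : ‖w‖ = 0
  · rw [hw0]; positivity
  · have : 0 < ‖w‖ := lt_of_le_of_ne (norm_nonneg _) (Ne.symm hw0)
    rw [sq] at h2
    exact le_of_mul_le_mul_left h2 this

end Representation

/-! ### Paulsen's off-diagonal argument for scalar diagonal blocks. -/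

section OffDiagonal

/-- A scalar matrix whose quadratic form has positive real part has a real part of the form
`Rᴴ R` with `R` invertible. -/
theorem exists_factor_of_re_pos {n : ℕ} (M : Matrix (Fin n) (Fin n) ℂ)
    (hM : ∀ v : Fin n → ℂ, v ≠ 0 → 0 < (∑ i, ∑ j, star (v i) * M i j * v j).re) :
    ∃ R S : Matrix (Fin n) (Fin n) ℂ, S * R = 1 ∧ R * S = 1 ∧
      ∀ i j, M i j + star (M j i) = 2 * ∑ l, star (R l i) * R l j := by
  open scoped MatrixOrder ComplexOrder in
  let N : Matrix (Fin n) (Fin n) ℂ := (2⁻¹ : ℂ) • (M + M.conjTranspose)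
  have hN : N.IsHermitian := by
    ext i j
    simp [N, add_comm]
  have hform : ∀ v : Fin n → ℂ, star v ⬝ᵥ (N.mulVec v) =
      (((∑ i, ∑ j, star (v i) * M i j * v j).re : ℝ) : ℂ) := by
    intro v
    set q := ∑ i, ∑ j, star (v i) * M i j * v j with hq
    have hq' : star q = ∑ i, ∑ j, star (v i) * star (M j i) * v j := by
      rw [hq, star_sum]
      simp only [star_sum, star_mul', star_star]
      rw [Finset.sum_comm]
      refine Finset.sum_congr rfl fun i _ => ?_
      refine Finset.sum_congr rfl fun j _ => by ring
    have h1 : star v ⬝ᵥ (N.mulVec v) = 2⁻¹ * (q + star q) := by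
      rw [hq', hq, ← Finset.sum_add_distrib, Finset.mul_sum]
      refine Finset.sum_congr rfl fun i _ => ?_
      rw [← Finset.sum_add_distrib, Finset.mul_sum, Matrix.mulVec, dotProduct, Finset.mul_sum]
      refine Finset.sum_congr rfl fun j _ => ?_
      simp [N]
      ring
    rw [h1]
    apply Complex.ext <;> simp
    ring
  have hpos : N.PosDef := by
    refine .of_dotProduct_mulVec_pos hN fun v hv => ?_
    rw [hform]
    exact_mod_cast hM v hv
  obtain ⟨R, hR⟩ := CStarAlgebra.nonneg_iff_eq_star_mul_self.mp hpos.posSemidef.nonneg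
  have hunit : IsUnit R := by
    have h := hpos.isUnit
    rw [Matrix.isUnit_iff_isUnit_det] at h ⊢
    rw [hR, Matrix.det_mul] at h
    exact isUnit_of_mul_isUnit_right h
  have hdet := (Matrix.isUnit_iff_isUnit_det _).1 hunit
  refine ⟨R, R⁻¹, Matrix.nonsing_inv_mul _ hdet, Matrix.mul_nonsing_inv _ hdet, fun i j => ?_⟩
  have := congrFun (congrFun hR i) j
  rw [Matrix.mul_apply] at this
  simp only [Matrix.star_apply] at this
  rw [← this]
  simp [N]
  ring

variable {H : Type u} {K : Type v} [NormedAddCommGroup H] [InnerProductSpace ℂ H]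
  [NormedAddCommGroup K] [InnerProductSpace ℂ K]

theorem sum_inner_conj_matrix {n : ℕ} (S : Matrix (Fin n) (Fin n) ℂ)
    (D : Fin n → Fin n → H →L[ℂ] K) (k : Fin n → K) (h : Fin n → H) :
    ∑ p, ∑ q, ⟪k p, (∑ i, ∑ j, (star (S i p) * S j q) • D i j) (h q)⟫_ℂ =
      ∑ i, ∑ j, ⟪∑ p, S i p • k p, D i j (∑ q, S j q • h q)⟫_ℂ := by
  simp only [map_sum, map_smul, sum_inner, inner_sum, inner_smul_left, inner_smul_right,
    sum_apply, smul_apply, Finset.mul_sum]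
  conv_lhs => enter [2, p]; rw [Finset.sum_comm]; enter [2, i]; rw [Finset.sum_comm]
  rw [Finset.sum_comm]
  refine Finset.sum_congr rfl fun i _ => ?_
  rw [Finset.sum_comm]
  refine Finset.sum_congr rfl fun j _ => ?_
  rw [Finset.sum_comm]
  refine Finset.sum_congr rfl fun q _ => Finset.sum_congr rfl fun p _ => ?_
  rw [← starRingEnd_apply]
  ring

theorem sum_smul_sum_smul {n : ℕ} {S R : Matrix (Fin n) (Fin n) ℂ} (hSR : S * R = 1)
    (k : Fin n → K) (i : Fin n) : ∑ p, S i p • ∑ l, R p l • k l = k i := by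
  have : ∑ p, S i p • ∑ l, R p l • k l = ∑ l, (S * R) i l • k l := by
    simp only [Finset.smul_sum, smul_smul, Matrix.mul_apply, Finset.sum_smul]
    rw [Finset.sum_comm]
  rw [this, hSR]
  simp [Matrix.one_apply]

/-- The real part of the form of a scalar matrix that has real part `Rᴴ R`. -/
theorem re_sum_mul_inner {n : ℕ} {M R : Matrix (Fin n) (Fin n) ℂ}
    (hMR : ∀ i j, M i j + star (M j i) = 2 * ∑ l, star (R l i) * R l j) (k : Fin n → K) :
    (∑ i, ∑ j, M i j * ⟪k i, k j⟫_ℂ).re = ∑ l, ‖∑ i, R l i • k i‖ ^ 2 := by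
  set q := ∑ i, ∑ j, M i j * ⟪k i, k j⟫_ℂ with hq
  have hq' : star q = ∑ i, ∑ j, star (M j i) * ⟪k i, k j⟫_ℂ := by
    rw [hq, star_sum]
    simp only [star_sum, star_mul']
    rw [Finset.sum_comm]
    refine Finset.sum_congr rfl fun i _ => Finset.sum_congr rfl fun j _ => ?_
    rw [← starRingEnd_apply ⟪k j, k i⟫_ℂ, inner_conj_symm]
  have h1 : q + star q = 2 * ∑ l, ⟪∑ i, R l i • k i, ∑ i, R l i • k i⟫_ℂ := by
    rw [hq', hq, ← Finset.sum_add_distrib]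
    simp only [← Finset.sum_add_distrib, ← add_mul, hMR]
    simp only [sum_inner, inner_sum, inner_smul_left, inner_smul_right, Finset.mul_sum,
      Finset.sum_mul]
    conv_rhs => rw [Finset.sum_comm]; enter [2, i]; rw [Finset.sum_comm]
    rw [Finset.sum_comm]
    refine Finset.sum_congr rfl fun i _ => Finset.sum_congr rfl fun j _ =>
      Finset.sum_congr rfl fun l _ => ?_
    rw [← starRingEnd_apply]
    ring
  have h2 := congrArg Complex.re h1
  have h3 : ∀ w : K, (⟪w, w⟫_ℂ).re = ‖w‖ ^ 2 := fun w => (norm_sq_eq_re_inner (𝕜 := ℂ) w).symm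
  rw [show (2 : ℂ) = ((2 : ℝ) : ℂ) by norm_num, Complex.re_ofReal_mul, Complex.re_sum] at h2
  simp only [h3] at h2
  simp at h2
  linarith

theorem re_sum_add_smul_one_mul_inner {E : Type*} [NormedAddCommGroup E] [InnerProductSpace ℂ E]
    {n : ℕ} (M : Matrix (Fin n) (Fin n) ℂ) (ε : ℝ) (k : Fin n → E) :
    (∑ i, ∑ j, (M + (ε : ℂ) • (1 : Matrix (Fin n) (Fin n) ℂ)) i j * ⟪k i, k j⟫_ℂ).re =
      (∑ i, ∑ j, M i j * ⟪k i, k j⟫_ℂ).re + ε * ∑ i, ‖k i‖ ^ 2 := by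
  have h : ∀ w : E, (⟪w, w⟫_ℂ).re = ‖w‖ ^ 2 := fun w => (norm_sq_eq_re_inner (𝕜 := ℂ) w).symm
  have h' : ∀ i, ∑ j, (M + (ε : ℂ) • (1 : Matrix (Fin n) (Fin n) ℂ)) i j * ⟪k i, k j⟫_ℂ =
      ∑ j, M i j * ⟪k i, k j⟫_ℂ + ε * ⟪k i, k i⟫_ℂ := fun i => by
    simp [Matrix.one_apply, add_mul, Finset.sum_add_distrib, -inner_self_eq_norm_sq_to_K]
  simp only [h', Finset.sum_add_distrib, Complex.add_re, ← Finset.mul_sum, Complex.re_ofReal_mul]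
  rw [Complex.re_sum Finset.univ fun i => ⟪k i, k i⟫_ℂ]
  simp only [h]

/-- The threshold is 2 because `D` stands for both off-diagonal blocks: its self-adjoint part has
blocks `D/2` and `D*/2`. -/
theorem re_sum_inner_le {n : ℕ} (D : Matrix (Fin n) (Fin n) (H →L[ℂ] K)) (hD : ‖matrixOp D‖ ≤ 2)
    (k : Fin n → K) (h : Fin n → H) :
    0 ≤ ∑ i, ‖k i‖ ^ 2 + ∑ i, ‖h i‖ ^ 2 + (∑ i, ∑ j, ⟪k i, D i j (h j)⟫_ℂ).re := by
  have h1 := sum_norm_sq_le_matrixOp D h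
  have h2 : ‖matrixOp D‖ ^ 2 ≤ 2 ^ 2 := by gcongr
  have h3 : ∑ i, ‖∑ j, D i j (h j)‖ ^ 2 ≤ 4 * ∑ j, ‖h j‖ ^ 2 := by
    refine h1.trans ?_
    have : (0 : ℝ) ≤ ∑ j, ‖h j‖ ^ 2 := by positivity
    nlinarith
  have h4 : ∀ i, -(‖k i‖ ^ 2 + ‖∑ j, D i j (h j)‖ ^ 2 / 4) ≤ (∑ j, ⟪k i, D i j (h j)⟫_ℂ).re := by
    intro i
    rw [← inner_sum]
    have h5 := norm_inner_le_norm (𝕜 := ℂ) (k i) (∑ j, D i j (h j))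
    have h6 := (abs_le.1 ((Complex.abs_re_le_norm _).trans h5)).1
    nlinarith [sq_nonneg (‖k i‖ - ‖∑ j, D i j (h j)‖ / 2)]
  have h7 := Finset.sum_le_sum fun i (_ : i ∈ Finset.univ) => h4 i
  rw [← Complex.re_sum, Finset.sum_neg_distrib, Finset.sum_add_distrib, ← Finset.sum_div] at h7
  linarith

theorem norm_matrixOp_le_two {n : ℕ} (D : Matrix (Fin n) (Fin n) (H →L[ℂ] K))
    (hD : ∀ (k : Fin n → K) (h : Fin n → H),
      0 ≤ ∑ i, ‖k i‖ ^ 2 + ∑ i, ‖h i‖ ^ 2 + (∑ i, ∑ j, ⟪k i, D i j (h j)⟫_ℂ).re) :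
    ‖matrixOp D‖ ≤ 2 := by
  refine norm_matrixOp_le _ (by norm_num) fun h => ?_
  let w : Fin n → K := fun i => ∑ j, D i j (h j)
  -- The choice `k = -w/2` minimises `‖k‖² + Re ⟪k, w⟫`, with minimum `-‖w‖²/4`.
  have h1 := hD (fun i => ((-2⁻¹ : ℝ) : ℂ) • w i) h
  have h2 : ∀ i, (∑ j, ⟪((-2⁻¹ : ℝ) : ℂ) • w i, D i j (h j)⟫_ℂ).re = -2⁻¹ * ‖w i‖ ^ 2 := by
    intro i
    rw [← inner_sum, inner_smul_left, Complex.conj_ofReal, Complex.re_ofReal_mul]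
    exact congrArg _ (norm_sq_eq_re_inner (𝕜 := ℂ) (w i)).symm
  have h3 : ∀ i, ‖((-2⁻¹ : ℝ) : ℂ) • w i‖ ^ 2 = 4⁻¹ * ‖w i‖ ^ 2 := by
    intro i
    rw [norm_smul, Complex.norm_real, mul_pow]
    norm_num
  rw [Complex.re_sum] at h1
  simp only [h2, h3, ← Finset.mul_sum] at h1
  change ∑ i, ‖w i‖ ^ 2 ≤ _
  linarith

/-- **Paulsen's off-diagonal argument**: a completely contractive map preserves positivity of
`[Λ, D; D*, Λ]`. -/
theorem CompletelyContractive.re_nonneg [Nontrivial K] {A : Submodule ℂ (H →L[ℂ] K)}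
    {P : A →ₗ[ℂ] A} (hP : CompletelyContractive P) {n : ℕ} (M : Matrix (Fin n) (Fin n) ℂ)
    (D : Matrix (Fin n) (Fin n) A)
    (hD : ∀ (k : Fin n → K) (h : Fin n → H),
      0 ≤ (∑ i, ∑ j, M i j * ⟪k i, k j⟫_ℂ).re + (∑ i, ∑ j, M i j * ⟪h i, h j⟫_ℂ).re +
        (∑ i, ∑ j, ⟪k i, (D i j : H →L[ℂ] K) (h j)⟫_ℂ).re)
    (k : Fin n → K) (h : Fin n → H) :
    0 ≤ (∑ i, ∑ j, M i j * ⟪k i, k j⟫_ℂ).re + (∑ i, ∑ j, M i j * ⟪h i, h j⟫_ℂ).re +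
      (∑ i, ∑ j, ⟪k i, (P (D i j) : H →L[ℂ] K) (h j)⟫_ℂ).re := by
  -- Adding `ε` to the diagonal makes the real part of `M` positive definite, so that its factor `R`
  -- is invertible; then `ε → 0`.
  suffices hε : ∀ ε : ℝ, 0 < ε → 0 ≤ ((∑ i, ∑ j, M i j * ⟪k i, k j⟫_ℂ).re +
      (∑ i, ∑ j, M i j * ⟪h i, h j⟫_ℂ).re +
      (∑ i, ∑ j, ⟪k i, (P (D i j) : H →L[ℂ] K) (h j)⟫_ℂ).re) +
      ε * (∑ i, ‖k i‖ ^ 2 + ∑ i, ‖h i‖ ^ 2) by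
    set x := (∑ i, ∑ j, M i j * ⟪k i, k j⟫_ℂ).re + (∑ i, ∑ j, M i j * ⟪h i, h j⟫_ℂ).re +
      (∑ i, ∑ j, ⟪k i, (P (D i j) : H →L[ℂ] K) (h j)⟫_ℂ).re
    set y := ∑ i, ‖k i‖ ^ 2 + ∑ i, ‖h i‖ ^ 2
    have hlim : Filter.Tendsto (fun ε : ℝ => x + ε * y) (nhdsWithin 0 (Set.Ioi 0))
        (nhds (x + 0 * y)) :=
      (Continuous.tendsto (by fun_prop) 0).mono_left nhdsWithin_le_nhds
    rw [zero_mul, add_zero] at hlim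
    exact ge_of_tendsto hlim (Filter.eventually_of_mem self_mem_nhdsWithin hε)
  intro ε hε
  let M' : Matrix (Fin n) (Fin n) ℂ := M + (ε : ℂ) • 1
  have hM'K := re_sum_add_smul_one_mul_inner (E := K) M ε
  have hM'H := re_sum_add_smul_one_mul_inner (E := H) M ε
  -- Testing `hD` on `k i = v i • e`, `h = 0` with a unit vector `e` isolates the scalar form of
  -- `M`; this needs `K` nonzero.
  obtain ⟨e, he⟩ := exists_norm_eq K (zero_le_one : (0 : ℝ) ≤ 1)
  obtain ⟨R, S, hSR, hRS, hR⟩ := exists_factor_of_re_pos M' (by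
    intro v hv
    have h1 := hM'K (fun i => v i • e)
    have h2 := hD (fun i => v i • e) 0
    have h3 : ∑ i, ∑ j, M' i j * ⟪v i • e, v j • e⟫_ℂ = ∑ i, ∑ j, star (v i) * M' i j * v j := by
      refine Finset.sum_congr rfl fun i _ => Finset.sum_congr rfl fun j _ => ?_
      rw [inner_smul_left, inner_smul_right, inner_self_eq_norm_sq_to_K, he, starRingEnd_apply]
      simp
      ring
    rw [h3] at h1
    simp only [Pi.zero_apply, map_zero, inner_zero_right, mul_zero, Finset.sum_const_zero,
      Complex.zero_re, add_zero] at h2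
    rw [h1]
    have h4 : 0 < ∑ i, ‖v i • e‖ ^ 2 := by
      obtain ⟨i, hi⟩ := Function.ne_iff.1 hv
      refine Finset.sum_pos' (fun i _ => by positivity) ⟨i, Finset.mem_univ _, ?_⟩
      rw [norm_smul, he, mul_one]
      have : v i ≠ 0 := hi
      positivity
    have := mul_pos hε h4
    linarith)
  -- Conjugation by `S = R⁻¹` normalises the diagonal blocks to `1`, so the hypothesis becomes `‖D'‖
  -- ≤ 2`. `P` commutes with scalar conjugation, so contractivity applies to `D'` and conjugating by
  -- `R` undoes the change.
  let D' : Matrix (Fin n) (Fin n) A := fun p q => ∑ i, ∑ j, (star (S i p) * S j q) • D i j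
  have hD'2 : matrixNorm D' ≤ 2 := by
    refine norm_matrixOp_le_two _ fun k' h' => ?_
    have h1 := hD (fun i => ∑ p, S i p • k' p) (fun i => ∑ p, S i p • h' p)
    have hk := hM'K (fun i => ∑ p, S i p • k' p)
    have hh := hM'H (fun i => ∑ p, S i p • h' p)
    rw [re_sum_mul_inner hR] at hk hh
    simp only [sum_smul_sum_smul hRS] at hk hh
    have h2 := sum_inner_conj_matrix S (fun i j => (D i j : H →L[ℂ] K)) k' h'
    rw [← h2] at h1
    have h3 : ∀ p q, ((D'.map fun x => (x : H →L[ℂ] K)) p q) =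
        ∑ i, ∑ j, (star (S i p) * S j q) • (D i j : H →L[ℂ] K) := by
      intro p q
      change ((∑ i, ∑ j, (star (S i p) * S j q) • D i j : A) : H →L[ℂ] K) = _
      simp
    simp only [h3]
    have h4 : 0 ≤ ε * ∑ i, ‖∑ p, S i p • k' p‖ ^ 2 := by positivity
    have h5 : 0 ≤ ε * ∑ i, ‖∑ p, S i p • h' p‖ ^ 2 := by positivity
    linarith
  have hPD' := (hP n D').trans hD'2
  have h1 := re_sum_inner_le _ hPD' (fun l => ∑ i, R l i • k i) (fun l => ∑ i, R l i • h i)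
  rw [← re_sum_mul_inner hR, ← re_sum_mul_inner hR, hM'K, hM'H] at h1
  have h3 : ∀ p q, (((D'.map P).map fun x => (x : H →L[ℂ] K)) p q) =
      ∑ i, ∑ j, (star (S i p) * S j q) • (P (D i j) : H →L[ℂ] K) := by
    intro p q
    change ((P (∑ i, ∑ j, (star (S i p) * S j q) • D i j) : A) : H →L[ℂ] K) = _
    simp
  have h2 := sum_inner_conj_matrix S (fun i j => (P (D i j) : H →L[ℂ] K))
    (fun l => ∑ i, R l i • k i) (fun l => ∑ i, R l i • h i)
  simp only [h3, h2, sum_smul_sum_smul hSR] at h1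
  linarith

end OffDiagonal

/-! ### Operators on `K ⊕ H` and the transfer of `P` to the corner. -/

section Corner

variable {H : Type u} {K : Type v} [NormedAddCommGroup H] [InnerProductSpace ℂ H]
  [NormedAddCommGroup K] [InnerProductSpace ℂ K]

/-- The Hilbert space direct sum `K ⊕ H`. -/
def HilbertSum (K : Type v) (H : Type u) : Type (max v u) := WithLp 2 (K × H)

namespace HilbertSum

instance : NormedAddCommGroup (HilbertSum K H) :=
  inferInstanceAs (NormedAddCommGroup (WithLp 2 (K × H)))

instance : InnerProductSpace ℂ (HilbertSum K H) :=
  inferInstanceAs (InnerProductSpace ℂ (WithLp 2 (K × H)))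

instance [CompleteSpace K] [CompleteSpace H] : CompleteSpace (HilbertSum K H) :=
  inferInstanceAs (CompleteSpace (WithLp 2 (K × H)))

/-- The projection onto the first summand. -/
def fst : HilbertSum K H →L[ℂ] K := WithLp.fstL 2 ℂ K H

/-- The projection onto the second summand. -/
def snd : HilbertSum K H →L[ℂ] H := WithLp.sndL 2 ℂ K H

/-- The embedding of the first summand. -/
def inl : K →L[ℂ] HilbertSum K H :=
  ((WithLp.prodContinuousLinearEquiv 2 ℂ K H).symm : K × H →L[ℂ] WithLp 2 (K × H)) ∘L
    ContinuousLinearMap.inl ℂ K H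

/-- The embedding of the second summand. -/
def inr : H →L[ℂ] HilbertSum K H :=
  ((WithLp.prodContinuousLinearEquiv 2 ℂ K H).symm : K × H →L[ℂ] WithLp 2 (K × H)) ∘L
    ContinuousLinearMap.inr ℂ K H

@[simp] theorem fst_inl (k : K) : fst (inl k : HilbertSum K H) = k := rfl
@[simp] theorem snd_inl (k : K) : snd (inl k : HilbertSum K H) = 0 := rfl
@[simp] theorem fst_inr (h : H) : fst (inr h : HilbertSum K H) = 0 := rfl
@[simp] theorem snd_inr (h : H) : snd (inr h : HilbertSum K H) = h := rfl

theorem inner_eq (v w : HilbertSum K H) :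
    ⟪v, w⟫_ℂ = ⟪fst v, fst w⟫_ℂ + ⟪snd v, snd w⟫_ℂ := rfl

theorem norm_sq_eq (v : HilbertSum K H) : ‖v‖ ^ 2 = ‖fst v‖ ^ 2 + ‖snd v‖ ^ 2 :=
  WithLp.prod_norm_sq_eq_of_L2 v

end HilbertSum

open HilbertSum

/-- The embedding of `B(H, K)` into `B(K ⊕ H)` as the upper right corner. -/
def corner : (H →L[ℂ] K) →ₗ[ℂ] (HilbertSum K H →L[ℂ] HilbertSum K H) where
  toFun a := inl ∘L a ∘L snd
  map_add' a b := by ext v; simp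
  map_smul' t a := by ext v; simp

theorem corner_apply (a : H →L[ℂ] K) (v : HilbertSum K H) : corner a v = inl (a (snd v)) := rfl

/-- The upper right corner of an operator on `K ⊕ H`. -/
def cornerPart : (HilbertSum K H →L[ℂ] HilbertSum K H) →ₗ[ℂ] (H →L[ℂ] K) where
  toFun s := fst ∘L s ∘L inr
  map_add' a b := by ext v; simp
  map_smul' t a := by ext v; simp

theorem cornerPart_apply (s : HilbertSum K H →L[ℂ] HilbertSum K H) (h : H) :
    cornerPart s h = fst (s (inr h)) := rfl

theorem cornerPart_corner (a : H →L[ℂ] K) : cornerPart (corner a) = a := by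
  ext h
  simp [cornerPart_apply, corner_apply]

theorem cornerPart_one : cornerPart (1 : HilbertSum K H →L[ℂ] HilbertSum K H) = 0 := by
  ext h
  simp [cornerPart_apply]

theorem norm_matrixOp_corner {n : ℕ} (a : Matrix (Fin n) (Fin n) (H →L[ℂ] K)) :
    ‖matrixOp (a.map corner)‖ = ‖matrixOp a‖ := by
  have hsum : ∀ (v : Fin n → HilbertSum K H) (i : Fin n),
      ‖∑ j, (a.map corner) i j (v j)‖ ^ 2 = ‖∑ j, a i j (snd (v j))‖ ^ 2 := by
    intro v i
    have : ∑ j, (a.map corner) i j (v j) = inl (∑ j, a i j (snd (v j))) := by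
      simp [corner_apply]
    rw [this, HilbertSum.norm_sq_eq]
    simp
  apply le_antisymm
  · refine norm_matrixOp_le _ (ContinuousLinearMap.opNorm_nonneg _) fun v => ?_
    simp only [hsum]
    refine (sum_norm_sq_le_matrixOp a fun j => (snd (v j))).trans ?_
    gcongr with j
    rw [← sq_le_sq₀ (norm_nonneg _) (norm_nonneg _), HilbertSum.norm_sq_eq (v j)]
    have := sq_nonneg ‖fst (v j)‖
    linarith
  · refine norm_matrixOp_le _ (ContinuousLinearMap.opNorm_nonneg _) fun h => ?_
    have := sum_norm_sq_le_matrixOp (a.map corner) (fun j => (inr (h j) : HilbertSum K H))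
    simp only [hsum] at this
    simpa [HilbertSum.norm_sq_eq] using this

variable [CompleteSpace H] [CompleteSpace K]

theorem star_corner_apply (a : H →L[ℂ] K) (v : HilbertSum K H) :
    star (corner a) v = inr (ContinuousLinearMap.adjoint a (fst v)) := by
  refine ext_inner_left ℂ fun w => ?_
  rw [ContinuousLinearMap.star_eq_adjoint, ContinuousLinearMap.adjoint_inner_right, corner_apply]
  simp [inner_eq, ContinuousLinearMap.adjoint_inner_right]

theorem cornerPart_star_corner (a : H →L[ℂ] K) : cornerPart (star (corner a)) = 0 := by
  ext h
  simp [cornerPart_apply, star_corner_apply]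

theorem corner_mul_star_mul (x y z : H →L[ℂ] K) :
    corner x * star (corner y) * corner z =
      corner (x ∘L ContinuousLinearMap.adjoint y ∘L z) := by
  ext v; simp [corner_apply, star_corner_apply]

/-- The operators `λ + a + b*` with `a`, `b` in the corner given by `A`. -/
def offDiagonalSystem (A : Submodule ℂ (H →L[ℂ] K)) :
    Submodule ℂ (HilbertSum K H →L[ℂ] HilbertSum K H) where
  carrier := {s | ∃ t : ℂ, ∃ a b : A, s = t • 1 + corner (a : H →L[ℂ] K) +
    star (corner (b : H →L[ℂ] K))}
  add_mem' := by
    rintro _ _ ⟨t, a, b, rfl⟩ ⟨t', a', b', rfl⟩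
    refine ⟨t + t', a + a', b + b', ?_⟩
    simp only [add_smul, Submodule.coe_add, map_add, star_add]
    abel
  zero_mem' := ⟨0, 0, 0, by simp⟩
  smul_mem' := by
    rintro r _ ⟨t, a, b, rfl⟩
    refine ⟨r * t, r • a, star r • b, ?_⟩
    simp only [mul_smul, Submodule.coe_smul, map_smul, star_smul, star_star, smul_add]

/-- The map `λ + a + b* ↦ λ + Q a + (Q b)*`, extended to all of `B(K ⊕ H)`. -/
def offDiagonalMap (Q : (H →L[ℂ] K) →ₗ[ℂ] (H →L[ℂ] K)) :
    (HilbertSum K H →L[ℂ] HilbertSum K H) →ₗ[ℂ]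
      (HilbertSum K H →L[ℂ] HilbertSum K H) where
  toFun s := s + corner (Q (cornerPart s) - cornerPart s) +
    star (corner (Q (cornerPart (star s)) - cornerPart (star s)))
  map_add' s s' := by
    simp only [map_add, star_add, map_sub, star_sub]
    abel
  map_smul' t s := by
    simp only [map_smul, star_smul, map_sub, star_sub, star_star, RingHom.id_apply, smul_add,
      smul_sub]

theorem offDiagonalMap_apply (Q : (H →L[ℂ] K) →ₗ[ℂ] (H →L[ℂ] K)) (t : ℂ) (a b : H →L[ℂ] K) :
    offDiagonalMap Q (t • 1 + corner a + star (corner b)) =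
      t • 1 + corner (Q a) + star (corner (Q b)) := by
  simp only [offDiagonalMap, LinearMap.coe_mk, AddHom.coe_mk]
  simp only [star_add, star_smul, star_one, star_star, map_add, map_smul, cornerPart_one,
    cornerPart_corner, cornerPart_star_corner, smul_zero, zero_add, add_zero, map_sub, star_sub]
  abel

/-- The quadratic form of a matrix over `offDiagonalSystem`. -/
theorem re_sum_inner_offDiagonal {n : ℕ} (t : Matrix (Fin n) (Fin n) ℂ)
    (a b : Fin n → Fin n → H →L[ℂ] K) (ζ : Fin n → HilbertSum K H) :
    (∑ i, ∑ j, ⟪ζ i, (t i j • 1 + corner (a i j) + star (corner (b i j)) :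
        HilbertSum K H →L[ℂ] HilbertSum K H) (ζ j)⟫_ℂ).re =
      (∑ i, ∑ j, t i j * ⟪fst (ζ i), fst (ζ j)⟫_ℂ).re +
      (∑ i, ∑ j, t i j * ⟪(snd (ζ i)), (snd (ζ j))⟫_ℂ).re +
      (∑ i, ∑ j, ⟪fst (ζ i), (a i j + b j i) (snd (ζ j))⟫_ℂ).re := by
  have h1 : ∀ i j, ⟪ζ i, (t i j • 1 + corner (a i j) + star (corner (b i j)) :
      HilbertSum K H →L[ℂ] HilbertSum K H) (ζ j)⟫_ℂ =
      t i j * ⟪fst (ζ i), fst (ζ j)⟫_ℂ + t i j * ⟪(snd (ζ i)), (snd (ζ j))⟫_ℂ +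
      ⟪fst (ζ i), a i j (snd (ζ j))⟫_ℂ + ⟪b i j (snd (ζ i)), fst (ζ j)⟫_ℂ := by
    intro i j
    simp only [add_apply, smul_apply, one_apply_eq_self, inner_add_right, inner_smul_right,
      corner_apply, star_corner_apply, inner_eq, fst_inl, snd_inl, fst_inr, snd_inr,
      inner_zero_right, ContinuousLinearMap.adjoint_inner_right]
    ring
  have h2 : (∑ i, ∑ j, ⟪b i j (snd (ζ i)), fst (ζ j)⟫_ℂ).re =
      (∑ i, ∑ j, ⟪fst (ζ i), b j i (snd (ζ j))⟫_ℂ).re := by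
    rw [Finset.sum_comm, ← Complex.conj_re]
    simp only [map_sum, inner_conj_symm]
  simp only [h1]
  simp only [Finset.sum_add_distrib, Complex.add_re, h2, add_apply, inner_add_right]
  ring

theorem CompletelyContractive.exists_isUCP [Nontrivial K] {A : Submodule ℂ (H →L[ℂ] K)}
    {P : A →ₗ[ℂ] A} (hP : CompletelyContractive P) :
    ∃ Φ : (HilbertSum K H →L[ℂ] HilbertSum K H) →ₗ[ℂ]
        (HilbertSum K H →L[ℂ] HilbertSum K H),
      IsUCP Φ ∧ ∀ a : A, Φ (corner (a : H →L[ℂ] K)) = corner (P a : H →L[ℂ] K) := by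
  -- A purely algebraic extension of `P`, with no bound; only its values on `A` matter.
  obtain ⟨Q, hQ⟩ := LinearMap.exists_extend (A.subtype ∘ₗ P)
  have hQA : ∀ a : A, Q a = P a := fun a => LinearMap.congr_fun hQ a
  have hone : (1 : HilbertSum K H →L[ℂ] HilbertSum K H) ∈ offDiagonalSystem A :=
    ⟨1, 0, 0, by simp⟩
  obtain ⟨Φ, hΦ, hΦS⟩ := exists_isUCP_extension (offDiagonalSystem A) hone (offDiagonalMap Q)
    (by simpa using offDiagonalMap_apply Q 1 0 0) (by
      intro n c hc hacc
      choose t a b hcab using hc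
      -- In the real part, `(b i j)*` in the lower left corner counts as `b i j` at the transposed
      -- position in the upper right one.
      have hD := hP.re_nonneg t (fun i j => a i j + b j i) (fun k h => by
        have := hacc (fun i => inl (k i) + inr (h i))
        simp only [hcab] at this
        rw [re_sum_inner_offDiagonal t (fun i j => (a i j : H →L[ℂ] K))
          (fun i j => (b i j : H →L[ℂ] K))] at this
        simpa using this)
      intro ζ
      simp only [hcab, offDiagonalMap_apply, hQA]
      rw [re_sum_inner_offDiagonal t (fun i j => (P (a i j) : H →L[ℂ] K))
          (fun i j => (P (b i j) : H →L[ℂ] K))]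
      have := hD (fun i => fst (ζ i)) (fun i => (snd (ζ i)))
      simpa only [map_add, Submodule.coe_add] using this)
  refine ⟨Φ, hΦ, fun a => ?_⟩
  rw [hΦS _ ⟨0, a, 0, by simp⟩]
  have := offDiagonalMap_apply Q 0 (a : H →L[ℂ] K) 0
  simpa [hQA] using this

theorem CompletelyContractive.exists_idempotent_isUCP [Nontrivial K]
    {A : Submodule ℂ (H →L[ℂ] K)} {P : A →ₗ[ℂ] A} (hproj : ∀ x, P (P x) = P x)
    (hP : CompletelyContractive P) :
    ∃ Φ : (HilbertSum K H →L[ℂ] HilbertSum K H) →ₗ[ℂ]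
        (HilbertSum K H →L[ℂ] HilbertSum K H),
      IsUCP Φ ∧ (∀ a : A, Φ (corner (a : H →L[ℂ] K)) = corner (P a : H →L[ℂ] K)) ∧
        ∀ s, Φ (Φ s) = Φ s := by
  obtain ⟨Q, hQ⟩ := LinearMap.exists_extend (A.subtype ∘ₗ P)
  have hQA : ∀ a : A, Q a = P a := fun a => LinearMap.congr_fun hQ a
  obtain ⟨Ψ, hΨ, hΨA⟩ := hP.exists_isUCP
  obtain ⟨Φ, hΦ, hΦA, hid⟩ := TernaryRing.exists_idempotent_isUCP
    (Set.range fun a : A => corner (a : H →L[ℂ] K)) (fun s => corner (Q (cornerPart s)))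
    (by
      rintro _ ⟨a, rfl⟩
      exact ⟨P a, by simp [cornerPart_corner, hQA]⟩)
    (by
      rintro _ ⟨a, rfl⟩
      simp [cornerPart_corner, hQA, hproj])
    ⟨Ψ, hΨ, by
      rintro _ ⟨a, rfl⟩
      simp [cornerPart_corner, hQA, hΨA]⟩
  refine ⟨Φ, hΦ, fun a => ?_, hid⟩
  rw [hΦA _ ⟨a, rfl⟩, cornerPart_corner, hQA]

end Corner

/-! ### The range of `P` and the criterion for its image to be a TRO. -/

section Range

variable {H : Type u} {K : Type v} [NormedAddCommGroup H] [InnerProductSpace ℂ H]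
  [NormedAddCommGroup K] [InnerProductSpace ℂ K]

theorem CompletelyContractive.norm_map_le {A : Submodule ℂ (H →L[ℂ] K)} {P : A →ₗ[ℂ] A}
    (hP : CompletelyContractive P) (a : A) : ‖P a‖ ≤ ‖a‖ := by
  have := hP 1 (Matrix.of fun _ _ => a)
  have h1 : matrixNorm (Matrix.of fun _ _ : Fin 1 => a) = ‖a‖ :=
    norm_matrixOp_fin_one (a : H →L[ℂ] K)
  have h2 : matrixNorm ((Matrix.of fun _ _ : Fin 1 => a).map P) = ‖P a‖ :=
    norm_matrixOp_fin_one (P a : H →L[ℂ] K)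
  rwa [h1, h2] at this

theorem mem_map_range_iff {A : Submodule ℂ (H →L[ℂ] K)} {P : A →ₗ[ℂ] A}
    (hproj : ∀ x, P (P x) = P x) {x : H →L[ℂ] K} :
    x ∈ (LinearMap.range P).map A.subtype ↔ ∃ a : A, P a = a ∧ (a : H →L[ℂ] K) = x := by
  constructor
  · rintro ⟨_, ⟨a, rfl⟩, rfl⟩
    exact ⟨P a, hproj a, rfl⟩
  · rintro ⟨a, ha, rfl⟩
    exact ⟨a, ⟨a, ha⟩, rfl⟩

/-- The range of an idempotent is its set of fixed points, and `P` is continuous. -/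
theorem isClosed_map_range {A : Submodule ℂ (H →L[ℂ] K)}
    (hA : IsClosed (A : Set (H →L[ℂ] K))) {P : A →ₗ[ℂ] A}
    (hproj : ∀ x, P (P x) = P x) (hP : CompletelyContractive P) :
    IsClosed (((LinearMap.range P).map A.subtype : Submodule ℂ (H →L[ℂ] K)) :
      Set (H →L[ℂ] K)) := by
  have hc : Continuous P :=
    AddMonoidHomClass.continuous_of_bound P 1 fun a => by simpa using hP.norm_map_le a
  have h1 : IsClosed {a : A | P a = a} := isClosed_eq hc continuous_id
  have h2 := hA.isClosedEmbedding_subtypeVal.isClosedMap _ h1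
  convert h2 using 1
  ext x
  exact mem_map_range_iff hproj

/-- A linear map that preserves matrix norms and turns some ternary operation of a closed subspace
into the ternary product has as its range a TRO that is completely isometric to that subspace. -/
theorem exists_isTRO_of_matrixNorm_eq [CompleteSpace K] {G : Type w} [NormedAddCommGroup G]
    [InnerProductSpace ℂ G] [CompleteSpace G] {X : Submodule ℂ (H →L[ℂ] K)}
    (hX : IsClosed (X : Set (H →L[ℂ] K))) (ρ : X →ₗ[ℂ] (G →L[ℂ] G))
    (hnorm : ∀ (n : ℕ) (a : Matrix (Fin n) (Fin n) X), ‖matrixOp (a.map ρ)‖ = matrixNorm a)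
    (hmul : ∀ x y z : X, ∃ w : X, ρ x * star (ρ y) * ρ z = ρ w) :
    IsTRO (LinearMap.range ρ) ∧ CompletelyIsometric X (LinearMap.range ρ) := by
  have hiso : ∀ x : X, ‖ρ x‖ = ‖x‖ := by
    intro x
    have := hnorm 1 (fun _ _ => x)
    have h1 : matrixNorm (fun _ _ : Fin 1 => x : Matrix (Fin 1) (Fin 1) X) = ‖x‖ :=
      norm_matrixOp_fin_one (x : H →L[ℂ] K)
    rw [h1] at this
    rw [← this]
    exact (norm_matrixOp_fin_one (ρ x)).symm
  let ρi : X →ₗᵢ[ℂ] (G →L[ℂ] G) := ⟨ρ, hiso⟩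
  have : CompleteSpace X := hX.completeSpace_coe
  refine ⟨⟨ρi.isometry.isClosedEmbedding.isClosed_range, ?_⟩,
    LinearEquiv.ofInjective ρ ρi.injective, fun n a => hnorm n a⟩
  rintro _ ⟨x, rfl⟩ _ ⟨y, rfl⟩ _ ⟨z, rfl⟩
  obtain ⟨w, hw⟩ := hmul x y z
  exact ⟨w, hw.symm⟩

end Range

end TernaryRing

end

/-! ### The theorem on ranges of completely contractive projections. -/

theorem mainTheorem4 {H : Type u} {K : Type v}
    [NormedAddCommGroup H] [InnerProductSpace ℂ H] [CompleteSpace H]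
    [NormedAddCommGroup K] [InnerProductSpace ℂ K] [CompleteSpace K]
    (A : Submodule ℂ (H →L[ℂ] K)) (hA : TernaryRing.IsTRO A)
    (P : A →ₗ[ℂ] A) (hproj : ∀ x, P (P x) = P x)
    (hP : TernaryRing.CompletelyContractive P) :
    ∃ (H' : Type (max u v)) (K' : Type (max u v))
      (_ : NormedAddCommGroup H') (_ : InnerProductSpace ℂ H') (_ : CompleteSpace H')
      (_ : NormedAddCommGroup K') (_ : InnerProductSpace ℂ K') (_ : CompleteSpace K')
      (B : Submodule ℂ (H' →L[ℂ] K')),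
      TernaryRing.IsTRO B ∧
        TernaryRing.CompletelyIsometric ((LinearMap.range P).map A.subtype) B := by
  open TernaryRing in
  have hclosed := isClosed_map_range hA.isClosed hproj hP
  rcases subsingleton_or_nontrivial K with hK | hK
  -- For `K = 0` there is no unit vector for the off-diagonal argument, but then `B(H, K) = 0` and
  -- the zero map serves.
  · let G := HilbertSum K H
    have hsub : Subsingleton (H →L[ℂ] K) := ⟨fun a b => by ext h; exact Subsingleton.elim _ _⟩
    refine ⟨G, G, inferInstance, inferInstance, inferInstance, inferInstance, inferInstance,
      inferInstance, _, exists_isTRO_of_matrixNorm_eq hclosed 0 (fun n a => ?_)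
        fun x y z => ⟨0, by simp⟩⟩
    have h1 : ‖matrixOp (a.map (0 : (LinearMap.range P).map A.subtype →ₗ[ℂ] (G →L[ℂ] G)))‖ ≤ 0 :=
      norm_matrixOp_le _ le_rfl fun ζ => by simp
    have h2 : matrixNorm a ≤ 0 := norm_matrixOp_le _ le_rfl fun ζ => by
      simp [Subsingleton.elim _ (0 : H →L[ℂ] K)]
    exact le_antisymm (h1.trans (ContinuousLinearMap.opNorm_nonneg _))
      (h2.trans (ContinuousLinearMap.opNorm_nonneg _))
  · obtain ⟨Φ, hΦ, hΦA, hid⟩ := hP.exists_idempotent_isUCP hproj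
    have hfix : ∀ x : (LinearMap.range P).map A.subtype,
        Φ (corner (x : H →L[ℂ] K)) = corner (x : H →L[ℂ] K) := by
      rintro ⟨x, hx⟩
      obtain ⟨a, ha, rfl⟩ := (mem_map_range_iff hproj).1 hx
      rw [hΦA, ha]
    let ρ : (LinearMap.range P).map A.subtype →ₗ[ℂ] (Dilation hΦ →L[ℂ] Dilation hΦ) :=
      repLinear hΦ hid ∘ₗ corner ∘ₗ ((LinearMap.range P).map A.subtype).subtype
    refine ⟨Dilation hΦ, Dilation hΦ, inferInstance, inferInstance, inferInstance, inferInstance,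
      inferInstance, inferInstance, _, exists_isTRO_of_matrixNorm_eq hclosed ρ (fun n a => ?_) ?_⟩
    · have h1 := norm_matrixOp_repLinear (hΦ := hΦ) hid
        ((a.map fun x => (x : H →L[ℂ] K)).map corner) (fun i j => hfix (a i j))
      rw [norm_matrixOp_corner] at h1
      exact h1
    · intro x y z
      have hmem : ∀ x : (LinearMap.range P).map A.subtype, (x : H →L[ℂ] K) ∈ A := by
        rintro ⟨x, hx⟩
        obtain ⟨a, ha, rfl⟩ := (mem_map_range_iff hproj).1 hx
        exact a.2
      -- The only use of ternary closure of `A`: `x y* z` lies in the domain of `P`, and `Φ` sends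
      -- its corner to that of `P (x y* z)`.
      let t : A := ⟨_, hA.ternary_mem x (hmem x) y (hmem y) z (hmem z)⟩
      refine ⟨⟨P t, ⟨P t, ⟨t, rfl⟩, rfl⟩⟩, ?_⟩
      change repLinear hΦ hid (corner x) * star (repLinear hΦ hid (corner y)) *
        repLinear hΦ hid (corner z) = repLinear hΦ hid (corner (P t : H →L[ℂ] K))
      rw [star_repLinear, repLinear_mul hid (hfix x), repLinear_mul hid (hid _),
        hΦ.map_map_mul_right hid (hfix z), corner_mul_star_mul, ← hΦA t]
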